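/- For a Boolean function $f:\mathbb{Z}_2^n\to\mathbb{Z}_2$ and a permutation $\sigma\in\mathcal{S}_n$ let $f_\sigma(x_1,\dots,x_n)=f(x_{\sigma(1)},\dots,x_{\sigma(n)})$. For $0\le k\le n$, call $f$ $(n-k)$-symmetric if there is a set of $n-k$ variables such that no reordering of these variables changes $f$. Say that $f$ can be locally corrected from noise rate $\varepsilon$ using $q$ non-adaptive queries if there is a randomized algorithm (which may depend on $f$) that, given any point $x\in\mathbb{Z}_2^n$ and black-box access to any function $g:\mathbb{Z}_2^n\to\mathbb{Z}_2$ which differs from some $f_\sigma$ ($\sigma\in\mathcal{S}_n$ unknown) on at most $\varepsilon 2^n$ inputs, queries $g$ at $q$ points chosen (possibly at random) in advance, independently of the answers, and outputs $f_\sigma(x)$ with probability at least $2/3$. Theorem. There are an absolute constant $C>0$ and a sequence $(\delta_n)$ with $\delta_n\to 0$ as $n\to\infty$ such that, for all integers $0\le k\le n$, all but at most a $\delta_n$ fraction of the $(n-k)$-symmetric functions $f:\mathbb{Z}_2^n\to\mathbb{Z}_2$ can be locally corrected from noise rate $0.001$ using at most $C\,k\log^2(k+1)$ non-adaptive queries.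 (For $k\ge 2$ this is $O(k\log^2 k)$.) -/

import Mathlib

open Filter Topology

/-- The cube `ℤ₂ⁿ`. -/
abbrev Cube (n : ℕ) : Type := Fin n → ZMod 2

/-- Boolean functions `ℤ₂ⁿ → ℤ₂`. -/
abbrev BoolFun (n : ℕ) : Type := Cube n → ZMod 2

/-- The isomorphic copy `f_σ(x₁, …, xₙ) = f(x_{σ(1)}, …, x_{σ(n)})` of `f`. -/
def BoolFun.permute {n : ℕ} (f : BoolFun n) (σ : Equiv.Perm (Fin n)) : BoolFun n :=
  fun x => f (fun i => x (σ i))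

/-- `f` is symmetric with respect to the variables in `S`: no reordering of these variables
(leaving the other variables in place) changes `f`. -/
def BoolFun.IsSymmetricOn {n : ℕ} (f : BoolFun n) (S : Finset (Fin n)) : Prop :=
  ∀ π : Equiv.Perm (Fin n), (∀ i, i ∉ S → π i = i) → f.permute π = f

/-- `f` is `t`-symmetric: it is symmetric with respect to some set of `t` variables. -/
def BoolFun.IsPartiallySymmetric {n : ℕ} (t : ℕ) (f : BoolFun n) : Prop :=
  ∃ S : Finset (Fin n), S.card = t ∧ f.IsSymmetricOn S

/-- `g` is `ε`-close to `h`: they differ on at most an `ε` fraction of the inputs. -/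
def BoolFun.IsClose {n : ℕ} (ε : ℝ) (g h : BoolFun n) : Prop :=
  ((Finset.univ.filter fun x : Cube n => g x ≠ h x).card : ℝ) / (2 : ℝ) ^ n ≤ ε

/-- A deterministic non-adaptive procedure making `q` queries: the list of query points is fixed
in advance, and the output is a function of the `q` answers. -/
structure NonadaptiveProcedure (n q : ℕ) where
  /-- The points to be queried. -/
  query : Fin q → Cube n
  /-- The output, as a function of the answers. -/
  decide : (Fin q → ZMod 2) → ZMod 2

/-- The output of a procedure that is run with black-box access to `g`. -/
def NonadaptiveProcedure.output {n q : ℕ} (P : NonadaptiveProcedure n q) (g : BoolFun n) :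
    ZMod 2 :=
  P.decide fun j => g (P.query j)

/-- `f` is locally correctable from noise rate `ε` using `q` non-adaptive queries. A randomized
non-adaptive algorithm receives the point `x` and draws a deterministic non-adaptive procedure at
random, from a distribution which depends on `x` (and on the known function `f`) only.
For every `g` that is `ε`-close to some isomorphic copy `f_σ` of `f`, and for every `x`,
its output must be `f_σ(x)` with probability at least `2/3`. -/
def BoolFun.NonadaptivelyLocallyCorrectable {n : ℕ} (f : BoolFun n) (ε : ℝ) (q : ℕ) : Prop :=
  ∃ A : Cube n → PMF (NonadaptiveProcedure n q),
    ∀ (σ : Equiv.Perm (Fin n)) (g : BoolFun n), g.IsClose ε (f.permute σ) →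
      ∀ x : Cube n, 2 / 3 ≤ ((A x).map fun P => P.output g) (f.permute σ x)

/-- Two Boolean labellings with as many ones in each class of `ℓ` differ by a permutation
preserving `ℓ`. -/
theorem exists_perm_of_card_ones_eq {α β : Type*} [Fintype α] [DecidableEq β]
    (ℓ : α → β) (z z' : α → ZMod 2)
    (h : ∀ b, (Finset.univ.filter fun i => ℓ i = b ∧ z i = 1).card =
      (Finset.univ.filter fun i => ℓ i = b ∧ z' i = 1).card) :
    ∃ π : Equiv.Perm α, (∀ i, ℓ (π i) = ℓ i) ∧ ∀ i, z i = z' (π i) := by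
  classical
  have h0 : ∀ (y : α → ZMod 2) b, (Finset.univ.filter fun i => ℓ i = b ∧ y i = 0).card +
      (Finset.univ.filter fun i => ℓ i = b ∧ y i = 1).card =
      (Finset.univ.filter fun i => ℓ i = b).card := by
    intro y b
    rw [← Finset.card_union_of_disjoint]
    · congr 1
      ext i
      have : y i = 0 ∨ y i = 1 := by generalize y i = t; revert t; decide
      simp only [Finset.mem_union, Finset.mem_filter, Finset.mem_univ, true_and]
      tauto
    · rw [Finset.disjoint_filter]
      rintro i - ⟨-, h1⟩ ⟨-, h2⟩
      rw [h1] at h2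
      exact absurd h2 (by decide)
  have key : ∀ p : β × ZMod 2, Fintype.card {i // (ℓ i, z i) = p} =
      Fintype.card {i // (ℓ i, z' i) = p} := by
    rintro ⟨b, c⟩
    rw [Fintype.card_subtype, Fintype.card_subtype]
    simp only [Prod.mk.injEq]
    have hc : c = 0 ∨ c = 1 := by revert c; decide
    rcases hc with rfl | rfl
    · have := h0 z b
      have := h0 z' b
      have := h b
      omega
    · exact h b
  let e : α ≃ α := (Equiv.sigmaFiberEquiv fun i => (ℓ i, z i)).symm.trans
    ((Equiv.sigmaCongrRight fun p => Fintype.equivOfCardEq (key p)).trans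
      (Equiv.sigmaFiberEquiv fun i => (ℓ i, z' i)))
  have he : ∀ i, (ℓ (e i), z' (e i)) = (ℓ i, z i) := fun i =>
    (Fintype.equivOfCardEq (key (ℓ i, z i)) ⟨i, rfl⟩).2
  exact ⟨e, fun i => (Prod.ext_iff.1 (he i)).1, fun i => ((Prod.ext_iff.1 (he i)).2).symm⟩

/-- The Hamming weight. -/
def Cube.weight {n : ℕ} (z : Cube n) : ℕ := (Finset.univ.filter fun i => z i = 1).card

theorem Cube.weight_comp {n : ℕ} (z : Cube n) (π : Equiv.Perm (Fin n)) :
    Cube.weight (fun i => z (π i)) = z.weight := by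
  unfold Cube.weight
  exact Finset.card_bij (fun i _ => π i) (by simp) (by simp)
    (fun b hb => ⟨π.symm b, by simpa using hb, by simp⟩)

theorem Cube.weight_lt {n : ℕ} (z : Cube n) : z.weight < n + 1 := by
  have := Finset.card_filter_le (Finset.univ : Finset (Fin n)) fun i => z i = 1
  simp only [Finset.card_univ, Fintype.card_fin] at this
  exact Nat.lt_succ_of_le this

theorem Cube.exists_perm_of_weight_eq {n : ℕ} (z z' : Cube n) (h : z.weight = z'.weight) :
    ∃ π : Equiv.Perm (Fin n), z = fun i => z' (π i) := by
  obtain ⟨π, -, hπ⟩ := exists_perm_of_card_ones_eq (fun _ : Fin n => ()) z z'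
    (fun b => by simpa [Cube.weight] using h)
  exact ⟨π, funext hπ⟩

/-- The coordinates outside `S` together with the Hamming weight: what a function which is
symmetric on `S` may depend on. -/
def Cube.profile {n : ℕ} (S : Finset (Fin n)) (z : Cube n) : ({i // i ∉ S} → ZMod 2) × ℕ :=
  (fun i => z i, z.weight)

theorem BoolFun.IsSymmetricOn.eq_of_profile_eq {n : ℕ} {S : Finset (Fin n)} {f : BoolFun n}
    (hf : f.IsSymmetricOn S) {z z' : Cube n} (h : z.profile S = z'.profile S) : f z = f z' := by
  obtain ⟨h1, h2⟩ := Prod.ext_iff.1 h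
  have h1' : ∀ i, i ∉ S → z i = z' i := fun i hi => congrFun h1 ⟨i, hi⟩
  have hsplit : ∀ y : Cube n, (Finset.univ.filter fun i => i ∈ S ∧ y i = 1).card +
      (Finset.univ.filter fun i => i ∉ S ∧ y i = 1).card = y.weight := by
    intro y
    rw [← Finset.card_union_of_disjoint]
    · unfold Cube.weight
      congr 1
      ext i
      simp only [Finset.mem_union, Finset.mem_filter, Finset.mem_univ, true_and]
      tauto
    · rw [Finset.disjoint_filter]
      tauto
  have hout : (Finset.univ.filter fun i => i ∉ S ∧ z i = 1) =
      (Finset.univ.filter fun i => i ∉ S ∧ z' i = 1) := by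
    ext i
    simp only [Finset.mem_filter, Finset.mem_univ, true_and]
    exact ⟨fun ⟨a, b⟩ => ⟨a, h1' i a ▸ b⟩, fun ⟨a, b⟩ => ⟨a, (h1' i a).symm ▸ b⟩⟩
  have hw : z.weight = z'.weight := h2
  obtain ⟨π, hπ, hz⟩ := exists_perm_of_card_ones_eq
    (fun i : Fin n => if i ∈ S then none else some i) z z' (by
      rintro (_ | j)
      · have e1 := hsplit z
        have e2 := hsplit z'
        rw [hout] at e1
        simp only [ite_eq_left_iff, reduceCtorEq, imp_false, not_not]
        omega
      · congr 1
        ext i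
        simp only [Finset.mem_filter, Finset.mem_univ, true_and]
        by_cases hi : i ∈ S
        · simp [hi]
        · simp [hi, h1' i hi])
  have hfix : ∀ i, i ∉ S → π i = i := by
    intro i hi
    have := hπ i
    simp only [hi, if_false] at this
    by_cases hp : π i ∈ S
    · simp [hp] at this
    · simpa [hp] using this
  have := congrFun (hf π hfix) z'
  rw [BoolFun.permute, ← funext hz] at this
  exact this

theorem BoolFun.isSymmetricOn_of_profile {n : ℕ} {S : Finset (Fin n)} {f : BoolFun n}
    (h : ∀ z z' : Cube n, z.profile S = z'.profile S → f z = f z') : f.IsSymmetricOn S := by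
  intro π hπ
  funext z
  apply h
  refine Prod.ext (funext fun i => ?_) (Cube.weight_comp z π)
  change z (π i) = z i
  rw [hπ i i.2]

/-- The permutations of the variables fixing `x`. -/
def Cube.stab {n : ℕ} (x : Cube n) : Subgroup (Equiv.Perm (Fin n)) where
  carrier := {π | ∀ i, x (π i) = x i}
  one_mem' := fun _ => rfl
  mul_mem' := fun {a b} ha hb i => by rw [Equiv.Perm.mul_apply, ha, hb]
  inv_mem' := fun {a} ha i => by
    change x (a.symm i) = x i
    rw [← ha, Equiv.apply_symm_apply]

theorem Cube.mem_stab {n : ℕ} {x : Cube n} {π : Equiv.Perm (Fin n)} :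
    π ∈ x.stab ↔ ∀ i, x (π i) = x i := Iff.rfl

instance {n : ℕ} (x : Cube n) : DecidablePred (· ∈ x.stab) :=
  fun _ => decidable_of_iff _ Cube.mem_stab.symm

/-- A random element of the stabilizer maps `i` to a given point with probability at most the
inverse of the size of the fibre of `i`. -/
theorem Cube.card_stab_map_le {n : ℕ} (x : Cube n) (i i' : Fin n) :
    (Finset.univ.filter fun j => x j = x i).card *
      (Finset.univ.filter fun π : x.stab => π.1 i = i').card ≤ Fintype.card x.stab := by
  by_cases hi : x i' = x i
  · have hcard : ∀ j, x j = x i → (Finset.univ.filter fun π : x.stab => π.1 i = j).card =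
        (Finset.univ.filter fun π : x.stab => π.1 i = i').card := by
      intro j hj
      have hs : Equiv.swap j i' ∈ x.stab := by
        intro l
        rcases eq_or_ne l j with rfl | h1
        · simp [hj, hi]
        rcases eq_or_ne l i' with rfl | h2
        · simp [hj, hi]
        rw [Equiv.swap_apply_of_ne_of_ne h1 h2]
      refine Finset.card_bij (fun π _ => ⟨Equiv.swap j i', hs⟩ * π) ?_ ?_ ?_
      · intro π hπ
        simp only [Finset.mem_filter, Finset.mem_univ, true_and] at hπ
        simp [hπ]
      · intro a _ b _ hab
        exact mul_left_cancel hab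
      · intro π hπ
        simp only [Finset.mem_filter, Finset.mem_univ, true_and] at hπ
        refine ⟨⟨Equiv.swap j i', hs⟩⁻¹ * π, ?_, by simp⟩
        simp [hπ]
    have hsum := Finset.card_eq_sum_card_fiberwise (s := (Finset.univ : Finset x.stab))
      (f := fun π : x.stab => π.1 i) (t := Finset.univ.filter fun j => x j = x i)
      (fun π _ => by simpa using π.2 i)
    rw [Finset.sum_congr rfl fun j hj => hcard j (by simpa using hj), Finset.sum_const,
      smul_eq_mul, Finset.card_univ] at hsum
    exact hsum.ge
  · rw [Finset.filter_false_of_mem (s := (Finset.univ : Finset x.stab))]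
    · simp
    · rintro π - rfl
      exact hi (π.2 i)

/-- The randomness behind a single query. -/
abbrev Seed (n : ℕ) : Type := Cube n × (ZMod 2 → Bool)

/-- A template for queries to be made for the correction at `x`: a random point `point ω`, and a
partition of the variables into classes on which `x` is constant and most of which are constant
for `point ω`. -/
structure QueryDesign {n : ℕ} (x : Cube n) (k : ℕ) (K : Type) [DecidableEq K] where
  point : Seed n → Cube n
  cls : Fin n → K
  eq_of_cls_eq : ∀ i i', cls i = cls i' → x i = x i'
  mem_orbit : ∀ ω, ∃ π ∈ x.stab, point ω = fun i => ω.1 (π i)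
  flip : ∀ b : ZMod 2, ∃ Φ : Equiv.Perm (Seed n),
    ∀ ω i, point (Φ ω) i = if x i = b then point ω i + 1 else point ω i
  mismatch : ∀ ω i, 10000 * k * (Finset.univ.filter fun i' => x i' = x i ∧
      ∃ i'', cls i'' = cls i' ∧ point ω i'' ≠ point ω i').card ≤
    (Finset.univ.filter fun i' => x i' = x i).card

theorem card_filter_apply_mul {Ω : Type*} [Fintype Ω] (P : Ω → Prop)
    [DecidablePred P] {q : ℕ} (j : Fin q) :
    (Finset.univ.filter fun r : Fin q → Ω => P (r j)).card * Fintype.card Ω =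
      (Finset.univ.filter P).card * Fintype.card Ω ^ q := by
  classical
  have h1 : (Finset.univ.filter fun r : Fin q → Ω => P (r j)) =
      Fintype.piFinset fun i => if i = j then Finset.univ.filter P else Finset.univ := by
    ext r
    simp only [Finset.mem_filter, Finset.mem_univ, true_and, Fintype.mem_piFinset]
    constructor
    · intro h i
      split_ifs with hi
      · subst hi; simpa using h
      · simp
    · intro h
      simpa using h j
  rw [h1, Fintype.card_piFinset, ← Finset.mul_prod_erase _ _ (Finset.mem_univ j)]
  rw [Finset.prod_congr rfl (g := fun _ => Fintype.card Ω)]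
  · rw [Finset.prod_const, Finset.card_erase_of_mem (Finset.mem_univ j), Finset.card_univ,
      Fintype.card_fin]
    simp only [if_true]
    have : 0 < q := j.pos
    rw [mul_assoc, ← pow_succ, Nat.sub_add_cancel this]
  · intro i hi
    rw [if_neg (Finset.ne_of_mem_erase hi), Finset.card_univ]

/-- A Chernoff bound: an event of probability at least `1/32` rarely occurs at most `s` times in
`100 s` independent trials. -/
theorem card_few_occurrences_le {Ω : Type*} [Fintype Ω] (T : Ω → Prop) [DecidablePred T]
    (hT : Fintype.card Ω ≤ 32 * (Finset.univ.filter T).card) (s : ℕ) :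
    ((Finset.univ.filter fun r : Fin (100 * s) → Ω =>
        (Finset.univ.filter fun j => T (r j)).card ≤ s).card : ℝ) * 2 ^ s ≤
      (Fintype.card Ω : ℝ) ^ (100 * s) := by
  classical
  have hprod : ∀ r : Fin (100 * s) → Ω, ∏ j, (if T (r j) then (1 / 2 : ℝ) else 1) =
      (1 / 2) ^ (Finset.univ.filter fun j => T (r j)).card := by
    intro r
    rw [Finset.prod_ite]
    simp
  have hsum : ∑ ω : Ω, (if T ω then (1 / 2 : ℝ) else 1) ≤ (63 / 64) * Fintype.card Ω := by
    have h1 : ∀ ω : Ω, (if T ω then (1 / 2 : ℝ) else 1) = 1 - 1 / 2 * (if T ω then 1 else 0) := by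
      intro ω; split_ifs <;> norm_num
    rw [Finset.sum_congr rfl fun ω _ => h1 ω, Finset.sum_sub_distrib, ← Finset.mul_sum,
      Finset.sum_boole]
    have : (Fintype.card Ω : ℝ) ≤ 32 * ((Finset.univ.filter T).card : ℝ) := by exact_mod_cast hT
    simp only [Finset.sum_const, Finset.card_univ, nsmul_eq_mul, mul_one]
    linarith
  have hnn : 0 ≤ ∑ ω : Ω, (if T ω then (1 / 2 : ℝ) else 1) :=
    Finset.sum_nonneg fun ω _ => by split_ifs <;> norm_num
  have h2 : ((Finset.univ.filter fun r : Fin (100 * s) → Ω =>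
        (Finset.univ.filter fun j => T (r j)).card ≤ s).card : ℝ) ≤
      2 ^ s * (∑ ω : Ω, (if T ω then (1 / 2 : ℝ) else 1)) ^ (100 * s) := by
    rw [Fintype.sum_pow, Finset.mul_sum, ← Finset.sum_boole]
    refine Finset.sum_le_sum fun r _ => ?_
    rw [hprod]
    split_ifs with h
    · calc (1 : ℝ) = 2 ^ s * (1 / 2) ^ s := by rw [← mul_pow]; norm_num
        _ ≤ _ := by
          gcongr 2 ^ s * ?_
          exact pow_le_pow_of_le_one (by norm_num) (by norm_num) h
    · positivity
  have hnum : (2 * ((63 / 64 : ℝ) ^ 100) * 2) ≤ 1 := by norm_num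
  calc _ ≤ (2 ^ s * ((63 / 64) * (Fintype.card Ω : ℝ)) ^ (100 * s)) * 2 ^ s := by
        gcongr
        exact h2.trans (by gcongr)
    _ = (2 * ((63 / 64 : ℝ) ^ 100) * 2) ^ s * (Fintype.card Ω : ℝ) ^ (100 * s) := by
        rw [mul_pow, mul_pow, mul_pow, pow_mul]; ring
    _ ≤ 1 * _ := by
        gcongr
        exact pow_le_one₀ (by positivity) hnum
    _ = _ := one_mul _

theorem half_one_add_exp_neg_le {u : ℝ} (h0 : 0 ≤ u) (h1 : u ≤ 1) :
    1 + Real.exp (-u) ≤ 2 * Real.exp (-(u / 4)) := by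
  have h2 : Real.exp (-u) ≤ 1 - u + u ^ 2 / 2 := by
    have h3 : 1 + u + u ^ 2 / 2 ≤ Real.exp u := Real.quadratic_le_exp_of_nonneg h0
    rw [Real.exp_neg]
    rw [inv_le_comm₀ (Real.exp_pos _) (by nlinarith)]
    refine le_trans ?_ h3
    rw [inv_le_iff_one_le_mul₀ (by nlinarith)]
    nlinarith [pow_nonneg h0 4, pow_nonneg h0 2, pow_nonneg h0 3]
  have h4 := Real.add_one_le_exp (-(u / 4))
  nlinarith

theorem exp_add_exp_le {a b u : ℝ} (ha : 0 ≤ a) (hb : 0 ≤ b) (hab : a + b = u) (h1 : u ≤ 1) :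
    Real.exp (-a) + Real.exp (-b) ≤ 2 * Real.exp (-(u / 4)) := by
  refine le_trans ?_ (half_one_add_exp_neg_le (hab ▸ add_nonneg ha hb) h1)
  have e1 : Real.exp (-a) ≤ 1 := Real.exp_le_one_iff.2 (by linarith)
  have e2 : Real.exp (-b) ≤ 1 := Real.exp_le_one_iff.2 (by linarith)
  have e3 : Real.exp (-u) = Real.exp (-a) * Real.exp (-b) := by
    rw [← Real.exp_add, ← hab]; ring_nf
  nlinarith

/-- For a uniformly random function `F`, the values `F (α ω)` and `F (α' ω)` differ for a constant
fraction of all `ω ∈ T`, with overwhelming probability if `α` is spread and the images of `α` and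
`α'` are disjoint. -/
theorem card_few_differences_le {O Ω : Type*} [Fintype O] [DecidableEq O]
    (T : Finset Ω) (α α' : Ω → O) (p : O → Prop) (hp : ∀ ω ∈ T, p (α ω))
    (hp' : ∀ ω ∈ T, ¬ p (α' ω)) (B : ℝ) (hB : 0 < B)
    (hfib : ∀ o, ((T.filter fun ω => α ω = o).card : ℝ) ≤ B) :
    ((Finset.univ.filter fun F : O → ZMod 2 =>
        8 * (T.filter fun ω => F (α ω) ≠ F (α' ω)).card ≤ T.card).card : ℝ) ≤
      2 ^ Fintype.card O * Real.exp (-(T.card / (8 * B))) := by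
  classical
  set X : (O → ZMod 2) → ℝ := fun F => ((T.filter fun ω => F (α ω) ≠ F (α' ω)).card : ℝ) / B with hX
  let twist : (O → ZMod 2) → (O → ZMod 2) → (O → ZMod 2) :=
    fun G F o => F o + if p o then G o else 0
  have htw : ∀ G, ∑ F, Real.exp (-X (twist G F)) = ∑ F, Real.exp (-X F) := by
    intro G
    exact Fintype.sum_equiv (Equiv.addRight fun o => if p o then G o else 0) _ _ (fun F => rfl)
  let h : (O → ZMod 2) → O → ZMod 2 → ℝ := fun F o b =>
    Real.exp (-(((T.filter fun ω => α ω = o ∧ F o + b ≠ F (α' ω)).card : ℝ) / B))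
  have hfac : ∀ G F, Real.exp (-X (twist G F)) = ∏ o, h F o (G o) := by
    intro G F
    rw [← Real.exp_sum]
    congr 1
    rw [Finset.sum_neg_distrib, ← Finset.sum_div]
    congr 1
    rw [← Nat.cast_sum]
    simp only [hX]
    congr 2
    rw [Finset.card_eq_sum_card_fiberwise (f := α) (t := Finset.univ) (fun _ _ => Finset.mem_univ _)]
    refine Finset.sum_congr rfl fun o _ => ?_
    congr 1
    ext ω
    simp only [Finset.mem_filter]
    constructor
    · rintro ⟨⟨h1, h2⟩, rfl⟩
      refine ⟨h1, rfl, ?_⟩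
      simpa [twist, hp ω h1, hp' ω h1] using h2
    · rintro ⟨h1, rfl, h2⟩
      refine ⟨⟨h1, ?_⟩, rfl⟩
      simpa [twist, hp ω h1, hp' ω h1] using h2
  have hbd : ∀ F o, ∑ b, h F o b ≤
      2 * Real.exp (-(((T.filter fun ω => α ω = o).card : ℝ) / B / 4)) := by
    intro F o
    rw [show (Finset.univ : Finset (ZMod 2)) = {0, 1} from rfl, Finset.sum_pair (by decide)]
    refine exp_add_exp_le (by positivity) (by positivity) ?_ ?_
    · rw [← add_div, ← Nat.cast_add, ← Finset.card_union_of_disjoint]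
      · congr 3
        ext ω
        simp only [Finset.mem_union, Finset.mem_filter]
        generalize F o = s
        generalize F (α' ω) = t
        have : s + (0 : ZMod 2) ≠ t ∨ s + (1 : ZMod 2) ≠ t := by revert s t; decide
        tauto
      · rw [Finset.disjoint_filter]
        rintro ω - ⟨-, h1⟩ ⟨-, h2⟩
        revert h1 h2
        generalize F o = s
        generalize F (α' ω) = t
        revert s t
        decide
    · rw [div_le_one hB]
      exact hfib o
  have htot : ∑ o, ((T.filter fun ω => α ω = o).card : ℝ) = T.card := by
    rw [← Nat.cast_sum, ← Finset.card_eq_sum_card_fiberwise (fun _ _ => Finset.mem_univ _)]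
  have hcardF : (Fintype.card (O → ZMod 2) : ℝ) = 2 ^ Fintype.card O := by
    rw [Fintype.card_fun]; simp
  have havg : ∑ F, Real.exp (-X F) ≤ 2 ^ Fintype.card O * Real.exp (-(T.card / B / 4)) := by
    have h1 : (2 : ℝ) ^ Fintype.card O * ∑ F, Real.exp (-X F) ≤
        2 ^ Fintype.card O * (2 ^ Fintype.card O * Real.exp (-(T.card / B / 4))) := by
      calc (2 : ℝ) ^ Fintype.card O * ∑ F, Real.exp (-X F)
          = ∑ G : O → ZMod 2, ∑ F, Real.exp (-X (twist G F)) := by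
            rw [Finset.sum_congr rfl fun G _ => htw G, Finset.sum_const, Finset.card_univ,
              nsmul_eq_mul, hcardF]
        _ = ∑ F, ∑ G : O → ZMod 2, ∏ o, h F o (G o) := by
            rw [Finset.sum_comm]
            simp only [hfac]
        _ = ∑ F, ∏ o, ∑ b, h F o b := by
            refine Finset.sum_congr rfl fun F _ => ?_
            rw [Finset.prod_univ_sum, Fintype.piFinset_univ]
        _ ≤ ∑ F : O → ZMod 2, ∏ o,
              (2 * Real.exp (-(((T.filter fun ω => α ω = o).card : ℝ) / B / 4))) := by
            refine Finset.sum_le_sum fun F _ => Finset.prod_le_prod (fun o _ => ?_) fun o _ => hbd F o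
            exact Finset.sum_nonneg fun b _ => (Real.exp_pos _).le
        _ = _ := by
            rw [Finset.sum_const, Finset.card_univ, nsmul_eq_mul, hcardF, Finset.prod_mul_distrib,
              ← Real.exp_sum, Finset.sum_neg_distrib, ← Finset.sum_div, ← Finset.sum_div, htot]
            simp
    exact le_of_mul_le_mul_left h1 (by positivity)
  have hmarkov : ((Finset.univ.filter fun F : O → ZMod 2 =>
        8 * (T.filter fun ω => F (α ω) ≠ F (α' ω)).card ≤ T.card).card : ℝ) *
        Real.exp (-(T.card / (8 * B))) ≤ ∑ F, Real.exp (-X F) := by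
    rw [← Finset.sum_boole, Finset.sum_mul]
    refine Finset.sum_le_sum fun F _ => ?_
    split_ifs with hF
    · rw [one_mul, Real.exp_le_exp, neg_le_neg_iff, hX]
      have : (8 : ℝ) * ((T.filter fun ω => F (α ω) ≠ F (α' ω)).card : ℝ) ≤ T.card := by
        exact_mod_cast hF
      rw [div_le_div_iff₀ hB (by positivity)]
      nlinarith
    · rw [zero_mul]; exact (Real.exp_pos _).le
  have hfin := hmarkov.trans havg
  have hsplit : Real.exp (-(T.card / B / 4)) =
      Real.exp (-(T.card / (8 * B))) * Real.exp (-(T.card / (8 * B))) := by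
    rw [← Real.exp_add]
    congr 1
    field_simp
    ring
  rw [hsplit, ← mul_assoc] at hfin
  exact le_of_mul_le_mul_right hfin (Real.exp_pos _)

namespace QueryDesign

variable {n k : ℕ} {x : Cube n} {K : Type} [DecidableEq K]

open Classical in
/-- A permutation which puts the variables outside `S` into given classes, if there is one. -/
noncomputable def repr (D : QueryDesign x k K) (S : Finset (Fin n)) (a : {i // i ∉ S} → K) :
    Equiv.Perm (Fin n) :=
  if h : ∃ σ : Equiv.Perm (Fin n), ∀ i : {i // i ∉ S}, D.cls (σ i) = a i then h.choose else 1

theorem cls_repr (D : QueryDesign x k K) (S : Finset (Fin n)) (σ : Equiv.Perm (Fin n))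
    (i : {i // i ∉ S}) : D.cls (D.repr S (fun i => D.cls (σ i)) i) = D.cls (σ i) := by
  have h : ∃ τ : Equiv.Perm (Fin n), ∀ i : {i // i ∉ S}, D.cls (τ i) = D.cls (σ i) :=
    ⟨σ, fun _ => rfl⟩
  rw [repr, dif_pos h]
  exact h.choose_spec i

/-- Hypotheses which lead to distinct values at `x` are told apart by a random query. -/
def Separates (D : QueryDesign x k K) (S : Finset (Fin n)) (f : BoolFun n) : Prop :=
  ∀ a a' : {i // i ∉ S} → K,
    f.permute (D.repr S a) x ≠ f.permute (D.repr S a') x →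
    Fintype.card (Seed n) ≤ 32 * (Finset.univ.filter fun ω : Seed n =>
      f.permute (D.repr S a) (D.point ω) ≠ f.permute (D.repr S a') (D.point ω)).card

theorem permute_repr (D : QueryDesign x k K) {S : Finset (Fin n)} {f : BoolFun n}
    (hf : f.IsSymmetricOn S) (σ : Equiv.Perm (Fin n)) (y : Cube n)
    (hy : ∀ i : {i // i ∉ S}, y (D.repr S (fun i => D.cls (σ i)) i) = y (σ i)) :
    f.permute (D.repr S fun i => D.cls (σ i)) y = f.permute σ y := by
  apply hf.eq_of_profile_eq
  refine Prod.ext (funext hy) ?_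
  change Cube.weight _ = Cube.weight _
  rw [Cube.weight_comp, Cube.weight_comp]

theorem card_query_filter (D : QueryDesign x k K) (Q : Cube n → Prop) [DecidablePred Q] :
    (Finset.univ.filter fun p : x.stab × Seed n => Q fun i => D.point p.2 (p.1.1 i)).card =
      Fintype.card x.stab * ((Finset.univ.filter Q).card * 4) := by
  have h1 : ∀ ω : Seed n, (Finset.univ.filter fun π : x.stab => Q fun i => D.point ω (π.1 i)).card =
      (Finset.univ.filter fun π : x.stab => Q fun i => ω.1 (π.1 i)).card := by
    intro ω
    obtain ⟨π₀, h₀, h⟩ := D.mem_orbit ω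
    refine Finset.card_bij (fun π _ => (⟨π₀, h₀⟩ : x.stab) * π) ?_ ?_ ?_
    · intro π hπ
      simpa [h] using hπ
    · intro a _ b _ hab
      exact mul_left_cancel hab
    · intro π hπ
      refine ⟨(⟨π₀, h₀⟩ : x.stab)⁻¹ * π, ?_, by simp⟩
      simpa [h] using hπ
  have h2 : ∀ π : Equiv.Perm (Fin n), (Finset.univ.filter fun u : Cube n =>
      Q fun i => u (π i)).card = (Finset.univ.filter Q).card := by
    intro π
    refine Finset.card_bij (fun u _ i => u (π i)) (by simp) ?_ ?_
    · intro a _ b _ hab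
      funext i
      have := congrFun hab (π.symm i)
      simpa using this
    · intro b hb
      exact ⟨fun i => b (π.symm i), by simpa using hb, by simp⟩
  calc (Finset.univ.filter fun p : x.stab × Seed n => Q fun i => D.point p.2 (p.1.1 i)).card
      = ∑ ω : Seed n, (Finset.univ.filter fun π : x.stab => Q fun i => D.point ω (π.1 i)).card := by
        simp only [Finset.card_filter]
        rw [Fintype.sum_prod_type, Finset.sum_comm]
    _ = ∑ ω : Seed n, (Finset.univ.filter fun π : x.stab => Q fun i => ω.1 (π.1 i)).card :=
        Finset.sum_congr rfl fun ω _ => h1 ω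
    _ = ∑ π : x.stab, ∑ _c : ZMod 2 → Bool,
          (Finset.univ.filter fun u : Cube n => Q fun i => u (π.1 i)).card := by
        simp only [Finset.card_filter]
        rw [Finset.sum_comm]
        refine Finset.sum_congr rfl fun π _ => ?_
        rw [Fintype.sum_prod_type, Finset.sum_comm]
    _ = _ := by
        simp only [h2]
        rw [Finset.sum_const, Finset.sum_const, Finset.card_univ, Finset.card_univ]
        have : Fintype.card (ZMod 2 → Bool) = 4 := by
          rw [Fintype.card_fun]; simp
        rw [this, smul_eq_mul, smul_eq_mul]
        ring

theorem card_mismatch_le (D : QueryDesign x k K) (S : Finset (Fin n))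
    (hS : Fintype.card {i // i ∉ S} = k) (σ : Equiv.Perm (Fin n)) (ω : Seed n) :
    10000 * (Finset.univ.filter fun π : x.stab => ∃ i : {i // i ∉ S}, ∃ i'',
        D.cls i'' = D.cls (π.1 (σ i)) ∧ D.point ω i'' ≠ D.point ω (π.1 (σ i))).card ≤
      Fintype.card x.stab := by
  rcases Nat.eq_zero_or_pos k with hk | hk
  · have : IsEmpty {i // i ∉ S} := by rw [← Fintype.card_eq_zero_iff, hS, hk]
    simp
  have hone : ∀ i : {i // i ∉ S}, 10000 * k * (Finset.univ.filter fun π : x.stab => ∃ i'',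
        D.cls i'' = D.cls (π.1 (σ i)) ∧ D.point ω i'' ≠ D.point ω (π.1 (σ i))).card ≤
      Fintype.card x.stab := by
    intro i
    set i₀ := σ i
    set B := Finset.univ.filter fun i' => x i' = x i₀ ∧
      ∃ i'', D.cls i'' = D.cls i' ∧ D.point ω i'' ≠ D.point ω i' with hB
    set F := (Finset.univ.filter fun i' => x i' = x i₀).card with hF
    have hFpos : 0 < F := Finset.card_pos.2 ⟨i₀, by simp⟩
    set N := (Finset.univ.filter fun π : x.stab => ∃ i'',
        D.cls i'' = D.cls (π.1 i₀) ∧ D.point ω i'' ≠ D.point ω (π.1 i₀)).card with hN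
    have h1 : N ≤ ∑ i' ∈ B, (Finset.univ.filter fun π : x.stab => π.1 i₀ = i').card := by
      rw [hN, Finset.card_eq_sum_card_fiberwise (f := fun π : x.stab => π.1 i₀) (t := B)]
      · refine Finset.sum_le_sum fun i' _ => Finset.card_le_card ?_
        exact Finset.filter_subset_filter _ (Finset.filter_subset _ _)
      · intro π hπ
        have := π.2 i₀
        simp only [Finset.coe_filter, Finset.mem_univ, true_and, Set.mem_ofPred_eq, hB] at hπ ⊢
        exact ⟨this, hπ⟩
    have h2 : F * N ≤ B.card * Fintype.card x.stab := by
      refine (Nat.mul_le_mul_left F h1).trans ?_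
      rw [Finset.mul_sum]
      refine (Finset.sum_le_sum fun i' _ => x.card_stab_map_le i₀ i').trans ?_
      simp
    have h3 : 10000 * k * B.card ≤ F := D.mismatch ω i₀
    refine Nat.le_of_mul_le_mul_left (c := F) ?_ hFpos
    calc F * (10000 * k * N) = 10000 * k * (F * N) := by ring
      _ ≤ 10000 * k * (B.card * Fintype.card x.stab) := Nat.mul_le_mul_left _ h2
      _ = (10000 * k * B.card) * Fintype.card x.stab := by ring
      _ ≤ F * Fintype.card x.stab := Nat.mul_le_mul_right _ h3
  refine Nat.le_of_mul_le_mul_left (c := k) ?_ hk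
  have hun : (Finset.univ.filter fun π : x.stab => ∃ i : {i // i ∉ S}, ∃ i'',
        D.cls i'' = D.cls (π.1 (σ i)) ∧ D.point ω i'' ≠ D.point ω (π.1 (σ i))).card ≤
      ∑ i : {i // i ∉ S}, (Finset.univ.filter fun π : x.stab => ∃ i'',
        D.cls i'' = D.cls (π.1 (σ i)) ∧ D.point ω i'' ≠ D.point ω (π.1 (σ i))).card := by
    classical
    refine le_trans (Finset.card_le_card ?_) Finset.card_biUnion_le
    intro π hπ
    simpa using hπ
  calc _ = 10000 * k * _ := by ring
    _ ≤ 10000 * k * _ := Nat.mul_le_mul_left _ hun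
    _ ≤ ∑ _i : {i // i ∉ S}, Fintype.card x.stab := by
        rw [Finset.mul_sum]; exact Finset.sum_le_sum fun i _ => hone i
    _ = k * Fintype.card x.stab := by simp [hS]

/-- Under a random stabilizing permutation, the answer to a random query rarely differs from what
the right hypothesis predicts. -/
theorem card_corrupted_le (D : QueryDesign x k K) {S : Finset (Fin n)}
    (hS : Fintype.card {i // i ∉ S} = k) {f : BoolFun n} (hf : f.IsSymmetricOn S)
    (σ : Equiv.Perm (Fin n)) {g : BoolFun n} (hg : g.IsClose (1 / 1000) (f.permute σ)) :
    10000 * (Finset.univ.filter fun p : x.stab × Seed n =>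
      f.permute (D.repr S fun i => D.cls (p.1.1 (σ i))) (D.point p.2) ≠
        g fun i => D.point p.2 (p.1.1 i)).card ≤
      11 * (Fintype.card x.stab * Fintype.card (Seed n)) := by
  classical
  set A := Finset.univ.filter fun p : x.stab × Seed n =>
      f.permute (D.repr S fun i => D.cls (p.1.1 (σ i))) (D.point p.2) ≠
        g fun i => D.point p.2 (p.1.1 i)
  set A₁ := Finset.univ.filter fun p : x.stab × Seed n =>
      g (fun i => D.point p.2 (p.1.1 i)) ≠ f.permute σ fun i => D.point p.2 (p.1.1 i)
  set A₂ := Finset.univ.filter fun p : x.stab × Seed n => ∃ i : {i // i ∉ S}, ∃ i'',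
        D.cls i'' = D.cls (p.1.1 (σ i)) ∧ D.point p.2 i'' ≠ D.point p.2 (p.1.1 (σ i))
  have hsub : A ⊆ A₁ ∪ A₂ := by
    intro p hp
    simp only [A, A₁, A₂, Finset.mem_union, Finset.mem_filter, Finset.mem_univ, true_and] at hp ⊢
    by_contra hcon
    push Not at hcon
    obtain ⟨h1, h2⟩ := hcon
    apply hp
    rw [h1]
    refine D.permute_repr hf (p.1.1 * σ) (D.point p.2) fun i => ?_
    exact h2 i _ (D.cls_repr S (p.1.1 * σ) i)
  have hseed : Fintype.card (Seed n) = 2 ^ n * 4 := by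
    rw [Fintype.card_prod, Fintype.card_fun, Fintype.card_fun]; simp
  have h1 : 1000 * A₁.card ≤ Fintype.card x.stab * Fintype.card (Seed n) := by
    rw [D.card_query_filter fun z => g z ≠ f.permute σ z, hseed]
    have : 1000 * (Finset.univ.filter fun z => g z ≠ f.permute σ z).card ≤ 2 ^ n := by
      rw [BoolFun.IsClose, div_le_iff₀ (by positivity)] at hg
      have : (1000 : ℝ) * ((Finset.univ.filter fun z => g z ≠ f.permute σ z).card : ℝ) ≤ 2 ^ n := by
        linarith
      exact_mod_cast this
    calc _ = Fintype.card x.stab *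
          ((1000 * (Finset.univ.filter fun z => g z ≠ f.permute σ z).card) * 4) := by ring
      _ ≤ _ := by gcongr
  have h2 : 10000 * A₂.card ≤ Fintype.card x.stab * Fintype.card (Seed n) := by
    have : A₂.card = ∑ ω : Seed n, (Finset.univ.filter fun π : x.stab => ∃ i : {i // i ∉ S}, ∃ i'',
        D.cls i'' = D.cls (π.1 (σ i)) ∧ D.point ω i'' ≠ D.point ω (π.1 (σ i))).card := by
      simp only [A₂, Finset.card_filter]
      rw [Fintype.sum_prod_type, Finset.sum_comm]
    rw [this, Finset.mul_sum]
    refine (Finset.sum_le_sum fun ω _ => D.card_mismatch_le S hS σ ω).trans ?_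
    rw [Finset.sum_const, Finset.card_univ, smul_eq_mul, mul_comm]
  have h3 := (Finset.card_le_card hsub).trans (Finset.card_union_le _ _)
  omega

/-- Maximum likelihood decoding corrects `f` at `x`. -/
theorem exists_correcting (D : QueryDesign x k K) [Fintype K] {S : Finset (Fin n)}
    (hS : Fintype.card {i // i ∉ S} = k) {f : BoolFun n} (hf : f.IsSymmetricOn S)
    (hD : D.Separates S f) {s : ℕ} (hs : 0 < s) (hsK : 10 * Fintype.card K ^ k ≤ 2 ^ s) :
    ∃ P : PMF (NonadaptiveProcedure n (100 * s)), ∀ (σ : Equiv.Perm (Fin n)) (g : BoolFun n),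
      g.IsClose (1 / 1000) (f.permute σ) →
        2 / 3 ≤ (P.map fun P => P.output g) (f.permute σ x) := by
  classical
  let H := {i // i ∉ S} → K
  have : Nonempty H := ⟨fun i => D.cls i⟩
  let err : (Fin (100 * s) → Seed n) → (Fin (100 * s) → ZMod 2) → H → ℕ := fun r ans a =>
    (Finset.univ.filter fun j => f.permute (D.repr S a) (D.point (r j)) ≠ ans j).card
  have hmin : ∀ r ans, ∃ a, ∀ a', err r ans a ≤ err r ans a' := fun r ans => Finite.exists_min _
  choose best hbest using hmin
  let R := x.stab × (Fin (100 * s) → Seed n)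
  let proc : R → NonadaptiveProcedure n (100 * s) := fun p =>
    ⟨fun j i => D.point (p.2 j) (p.1.1 i), fun ans => f.permute (D.repr S (best p.2 ans)) x⟩
  refine ⟨(PMF.uniformOfFintype R).map proc, fun σ g hg => ?_⟩
  let tr : x.stab → H := fun π i => D.cls (π.1 (σ i))
  have hval : ∀ π, f.permute (D.repr S (tr π)) x = f.permute σ x := by
    intro π
    have h1 := D.permute_repr hf (π.1 * σ) x fun i => D.eq_of_cls_eq _ _ (D.cls_repr S (π.1 * σ) i)
    refine h1.trans ?_
    unfold BoolFun.permute
    congr 1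
    funext i
    exact π.2 (σ i)
  let bad : x.stab → Seed n → Prop := fun π ω =>
    f.permute (D.repr S (tr π)) (D.point ω) ≠ g fun i => D.point ω (π.1 i)
  let Y : R → ℕ := fun p => (Finset.univ.filter fun j => bad p.1 (p.2 j)).card
  let dif : H → H → Seed n → Prop := fun a a' ω =>
    f.permute (D.repr S a) (D.point ω) ≠ f.permute (D.repr S a') (D.point ω)
  let E₁ := Finset.univ.filter fun p : R => s < 2 * Y p
  let E₂ := Finset.univ.filter fun p : R => ∃ a, f.permute (D.repr S (tr p.1)) x ≠
    f.permute (D.repr S a) x ∧ (Finset.univ.filter fun j => dif (tr p.1) a (p.2 j)).card ≤ s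
  let good := Finset.univ.filter fun p : R => (proc p).output g = f.permute σ x
  have hcover : (Finset.univ : Finset R) ⊆ good ∪ (E₁ ∪ E₂) := by
    intro p _
    by_contra hcon
    simp only [Finset.mem_union, not_or, good, E₁, E₂, Finset.mem_filter, Finset.mem_univ,
      true_and, not_exists, not_and, not_le, not_lt] at hcon
    obtain ⟨h1, h2, h3⟩ := hcon
    set ans : Fin (100 * s) → ZMod 2 := fun j => g fun i => D.point (p.2 j) (p.1.1 i)
    have h4 : f.permute (D.repr S (best p.2 ans)) x ≠ f.permute σ x := h1
    have h5 := h3 (best p.2 ans) (by rw [hval]; exact h4.symm)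
    have h6 : err p.2 ans (best p.2 ans) ≤ Y p := hbest p.2 ans (tr p.1)
    have h7 : (Finset.univ.filter fun j => dif (tr p.1) (best p.2 ans) (p.2 j)).card ≤
        Y p + err p.2 ans (best p.2 ans) := by
      refine le_trans (Finset.card_le_card ?_) (Finset.card_union_le _ _)
      intro j hj
      simp only [Finset.mem_union, Finset.mem_filter, Finset.mem_univ, true_and, dif, bad] at hj ⊢
      by_contra hc
      push Not at hc
      exact hj (hc.1.trans hc.2.symm)
    omega
  set W := Fintype.card (Seed n) with hW
  set G := Fintype.card x.stab with hG
  have hWpos : 0 < W := Fintype.card_pos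
  have hGpos : 0 < G := Fintype.card_pos
  have hR : Fintype.card R = G * W ^ (100 * s) := by
    simp only [R, Fintype.card_prod, Fintype.card_fun, Fintype.card_fin, hW, hG]
  have hE₁ : 100 * E₁.card ≤ 22 * Fintype.card R := by
    have h1 : s * E₁.card ≤ 2 * ∑ p : R, Y p := by
      rw [Finset.mul_sum]
      calc s * E₁.card = ∑ p ∈ E₁, s := by simp [mul_comm]
        _ ≤ ∑ p ∈ E₁, 2 * Y p := Finset.sum_le_sum fun p hp => by
            simp only [E₁, Finset.mem_filter] at hp
            exact hp.2.le
        _ ≤ _ := Finset.sum_le_sum_of_subset (Finset.subset_univ _)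
    have h2 : (∑ p : R, Y p) * W = 100 * s * ((Finset.univ.filter fun p : x.stab × Seed n =>
        bad p.1 p.2).card * W ^ (100 * s)) := by
      have h3 : ∑ p : R, Y p = ∑ π : x.stab, ∑ j : Fin (100 * s),
          (Finset.univ.filter fun r : Fin (100 * s) → Seed n => bad π (r j)).card := by
        rw [Fintype.sum_prod_type]
        refine Finset.sum_congr rfl fun π _ => ?_
        simp only [Y, Finset.card_filter]
        rw [Finset.sum_comm]
      have h4 : (Finset.univ.filter fun p : x.stab × Seed n => bad p.1 p.2).card =
          ∑ π : x.stab, (Finset.univ.filter fun ω => bad π ω).card := by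
        simp only [Finset.card_filter]
        rw [Fintype.sum_prod_type]
      rw [h3, h4, Finset.sum_mul, Finset.sum_mul, Finset.mul_sum]
      refine Finset.sum_congr rfl fun π _ => ?_
      rw [Finset.sum_mul, Finset.sum_congr rfl fun j _ => card_filter_apply_mul (bad π) j,
        Finset.sum_const, Finset.card_univ, Fintype.card_fin, smul_eq_mul]
    have h5 := D.card_corrupted_le hS hf σ hg
    change 10000 * (Finset.univ.filter fun p : x.stab × Seed n => bad p.1 p.2).card ≤
      11 * (G * W) at h5
    refine Nat.le_of_mul_le_mul_left (c := 100 * (s * W)) ?_ (by positivity)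
    calc 100 * (s * W) * (100 * E₁.card) = 10000 * W * (s * E₁.card) := by ring
      _ ≤ 10000 * W * (2 * ∑ p : R, Y p) := Nat.mul_le_mul_left _ h1
      _ = 20000 * ((∑ p : R, Y p) * W) := by ring
      _ = 200 * s * W ^ (100 * s) * (10000 * (Finset.univ.filter fun p : x.stab × Seed n =>
            bad p.1 p.2).card) := by rw [h2]; ring
      _ ≤ 200 * s * W ^ (100 * s) * (11 * (G * W)) := Nat.mul_le_mul_left _ h5
      _ = _ := by rw [hR]; ring
  have hE₂ : 10 * E₂.card ≤ Fintype.card R := by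
    have h1 : ∀ π : x.stab, ∀ a : H, (Finset.univ.filter fun r : Fin (100 * s) → Seed n =>
        f.permute (D.repr S (tr π)) x ≠ f.permute (D.repr S a) x ∧
          (Finset.univ.filter fun j => dif (tr π) a (r j)).card ≤ s).card * 2 ^ s ≤
        W ^ (100 * s) := by
      intro π a
      by_cases h : f.permute (D.repr S (tr π)) x ≠ f.permute (D.repr S a) x
      · have := card_few_occurrences_le (dif (tr π) a) (hD _ _ h) s
        simp only [h, true_and, ne_eq, not_false_eq_true]
        exact_mod_cast this
      · simp [h]
    have h2 : E₂.card ≤ ∑ π : x.stab, ∑ a : H,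
        (Finset.univ.filter fun r : Fin (100 * s) → Seed n =>
        f.permute (D.repr S (tr π)) x ≠ f.permute (D.repr S a) x ∧
          (Finset.univ.filter fun j => dif (tr π) a (r j)).card ≤ s).card := by
      have h3 : E₂.card = ∑ π : x.stab, (Finset.univ.filter fun r : Fin (100 * s) → Seed n =>
          ∃ a, f.permute (D.repr S (tr π)) x ≠ f.permute (D.repr S a) x ∧
          (Finset.univ.filter fun j => dif (tr π) a (r j)).card ≤ s).card := by
        simp only [E₂, Finset.card_filter]
        rw [Fintype.sum_prod_type]
      rw [h3]
      refine Finset.sum_le_sum fun π _ => ?_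
      refine le_trans (Finset.card_le_card ?_) Finset.card_biUnion_le
      intro r hr
      simpa using hr
    have hH : Fintype.card H = Fintype.card K ^ k := by
      simp only [H, Fintype.card_fun, hS]
    have h4 : E₂.card * 2 ^ s ≤ G * (Fintype.card K ^ k * W ^ (100 * s)) := by
      refine (Nat.mul_le_mul_right _ h2).trans ?_
      rw [Finset.sum_mul]
      calc _ ≤ ∑ _π : x.stab, ∑ _a : H, W ^ (100 * s) := by
            refine Finset.sum_le_sum fun π _ => ?_
            rw [Finset.sum_mul]
            exact Finset.sum_le_sum fun a _ => h1 π a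
        _ = _ := by simp [hH, hG]
    refine Nat.le_of_mul_le_mul_left (c := 2 ^ s) ?_ (by positivity)
    calc 2 ^ s * (10 * E₂.card) = 10 * (E₂.card * 2 ^ s) := by ring
      _ ≤ 10 * (G * (Fintype.card K ^ k * W ^ (100 * s))) := Nat.mul_le_mul_left _ h4
      _ = (10 * Fintype.card K ^ k) * (G * W ^ (100 * s)) := by ring
      _ ≤ 2 ^ s * (G * W ^ (100 * s)) := Nat.mul_le_mul_right _ hsK
      _ = _ := by rw [hR]
  have hgood : 2 * Fintype.card R ≤ 3 * good.card := by
    have h1 := (Finset.card_le_card hcover).trans (Finset.card_union_le _ _)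
    have h2 := Finset.card_union_le E₁ E₂
    rw [Finset.card_univ] at h1
    omega
  have hprob : (((PMF.uniformOfFintype R).map proc).map fun P => P.output g) (f.permute σ x) =
      good.card * ((Fintype.card R : ENNReal))⁻¹ := by
    rw [PMF.map_comp, PMF.map_apply, tsum_fintype]
    simp only [PMF.uniformOfFintype_apply, Function.comp_apply]
    rw [← Finset.sum_filter, Finset.sum_const, nsmul_eq_mul]
    congr 3
    ext p
    simp only [good, Finset.mem_filter, Finset.mem_univ, true_and]
    exact eq_comm
  rw [hprob, ← div_eq_mul_inv]
  have hRpos : Fintype.card R ≠ 0 := Fintype.card_ne_zero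
  rw [ENNReal.le_div_iff_mul_le (Or.inl (by exact_mod_cast hRpos))
    (Or.inl (ENNReal.natCast_ne_top _)), mul_comm, ← mul_div_assoc]
  refine ENNReal.div_le_of_le_mul ?_
  rw [mul_comm, mul_comm (good.card : ENNReal)]
  exact_mod_cast hgood

end QueryDesign

namespace QueryDesign

variable {n k : ℕ} {x : Cube n} {K : Type} [DecidableEq K]

theorem card_seed_eq (D : QueryDesign x k K) {i i' : Fin n} (h : x i ≠ x i') :
    Fintype.card (Seed n) =
      4 * (Finset.univ.filter fun ω => D.point ω i = 0 ∧ D.point ω i' = 1).card := by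
  let c : ZMod 2 → ZMod 2 → ℕ := fun b b' =>
    (Finset.univ.filter fun ω => D.point ω i = b ∧ D.point ω i' = b').card
  have hc : ∀ j : Fin n, ∀ b b', c b b' =
      c (if x i = x j then b + 1 else b) (if x i' = x j then b' + 1 else b') := by
    intro j b b'
    obtain ⟨Φ, hΦ⟩ := D.flip (x j)
    refine Finset.card_bij (fun ω _ => Φ ω) ?_ (fun _ _ _ _ h => Φ.injective h) ?_
    · intro ω hω
      simp only [Finset.mem_filter, Finset.mem_univ, true_and] at hω ⊢
      rw [hΦ, hΦ, hω.1, hω.2]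
      exact ⟨rfl, rfl⟩
    · intro ω hω
      refine ⟨Φ.symm ω, ?_, by simp⟩
      simp only [Finset.mem_filter, Finset.mem_univ, true_and] at hω ⊢
      have h1 := hΦ (Φ.symm ω) i
      have h2 := hΦ (Φ.symm ω) i'
      rw [Equiv.apply_symm_apply, hω.1] at h1
      rw [Equiv.apply_symm_apply, hω.2] at h2
      constructor
      · split_ifs at h1 <;> simp_all
      · split_ifs at h2 <;> simp_all
  have h1 : ∀ b b', c b b' = c (b + 1) b' := fun b b' => by
    rw [hc i b b', if_pos rfl, if_neg h.symm]
  have h2 : ∀ b b', c b b' = c b (b' + 1) := fun b b' => by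
    rw [hc i' b b', if_neg h, if_pos rfl]
  have hall : ∀ p : ZMod 2 × ZMod 2, c p.1 p.2 = c 0 1 := by
    have e1 := h1 0 1
    have e2 := h2 0 1
    have e3 := h1 0 0
    rw [show (1 : ZMod 2) + 1 = 0 from rfl] at e2
    rw [zero_add] at e1 e3
    rintro ⟨b, b'⟩
    have hb : b = 0 ∨ b = 1 := by revert b; decide
    have hb' : b' = 0 ∨ b' = 1 := by revert b'; decide
    rcases hb with rfl | rfl <;> rcases hb' with rfl | rfl <;> simp only <;> omega
  rw [← Finset.card_univ, Finset.card_eq_sum_card_fiberwise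
    (f := fun ω => (D.point ω i, D.point ω i')) (t := Finset.univ) fun _ _ => Finset.mem_univ _]
  simp only [Prod.ext_iff]
  rw [Finset.sum_congr rfl fun p _ => hall p]
  simp [c]

/-- Almost all functions which are symmetric on `S` are separated by a design whose queries have
spread out profiles. -/
theorem ncard_not_separates_le (D : QueryDesign x k K) [Fintype K] {S : Finset (Fin n)}
    (hS : Fintype.card {i // i ∉ S} = k) {B : ℝ} (hB : 0 < B)
    (hspread : ∀ (σ : Equiv.Perm (Fin n)) o, ((Finset.univ.filter fun ω : Seed n =>
      Cube.profile S (fun i => D.point ω (σ i)) = o).card : ℝ) ≤ B) :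
    ({f : BoolFun n | f.IsSymmetricOn S ∧ ¬ D.Separates S f}.ncard : ℝ) ≤
      ({f : BoolFun n | f.IsSymmetricOn S}.ncard : ℝ) *
        (((Fintype.card K : ℝ) ^ k) ^ 2 * Real.exp (-(Fintype.card (Seed n) / (32 * B)))) := by
  classical
  let O := Set.range (Cube.profile S)
  have : Fintype O := Fintype.ofFinite _
  let pr : Cube n → O := Set.rangeFactorization (Cube.profile S)
  have hpr : Function.Surjective pr := Set.rangeFactorization_surjective
  let Ψ : (O → ZMod 2) → BoolFun n := fun F z => F (pr z)
  have hΨinj : Function.Injective Ψ := by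
    intro F F' h
    funext o
    obtain ⟨z, rfl⟩ := hpr o
    exact congrFun h z
  have hΨsym : ∀ F, (Ψ F).IsSymmetricOn S := fun F =>
    BoolFun.isSymmetricOn_of_profile fun z z' h => congrArg F (Subtype.ext h)
  have hΨsurj : ∀ f : BoolFun n, f.IsSymmetricOn S → ∃ F, Ψ F = f := by
    intro f hf
    refine ⟨fun o => f (Function.surjInv hpr o), funext fun z => ?_⟩
    refine hf.eq_of_profile_eq ?_
    exact congrArg Subtype.val (Function.surjInv_eq hpr (pr z))
  have hsym : {f : BoolFun n | f.IsSymmetricOn S}.ncard = 2 ^ Fintype.card O := by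
    have : {f : BoolFun n | f.IsSymmetricOn S} = Ψ '' Set.univ := by
      ext f
      simp only [Set.mem_ofPred_eq, Set.image_univ, Set.mem_range]
      exact ⟨hΨsurj f, fun ⟨F, h⟩ => h ▸ hΨsym F⟩
    rw [this, Set.ncard_image_of_injective _ hΨinj, Set.ncard_univ, Nat.card_eq_fintype_card,
      Fintype.card_fun]
    simp
  let H := {i // i ∉ S} → K
  let E : H × H → Finset (O → ZMod 2) := fun p => Finset.univ.filter fun F =>
    (Ψ F).permute (D.repr S p.1) x ≠ (Ψ F).permute (D.repr S p.2) x ∧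
      32 * (Finset.univ.filter fun ω : Seed n => (Ψ F).permute (D.repr S p.1) (D.point ω) ≠
        (Ψ F).permute (D.repr S p.2) (D.point ω)).card < Fintype.card (Seed n)
  have hE : ∀ p, ((E p).card : ℝ) ≤
      2 ^ Fintype.card O * Real.exp (-(Fintype.card (Seed n) / (32 * B))) := by
    rintro ⟨a, a'⟩
    rcases (E (a, a')).eq_empty_or_nonempty with h0 | ⟨F₀, hF₀⟩
    · rw [h0]; simp only [Finset.card_empty, Nat.cast_zero]; positivity
    simp only [E, Finset.mem_filter, Finset.mem_univ, true_and] at hF₀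
    obtain ⟨hne, -⟩ := hF₀
    set σ := D.repr S a
    set σ' := D.repr S a'
    obtain ⟨j, hj⟩ : ∃ j : {i // i ∉ S}, x (σ j) ≠ x (σ' j) := by
      by_contra hcon
      push Not at hcon
      refine hne ((hΨsym F₀).eq_of_profile_eq (Prod.ext (funext hcon) ?_))
      exact (Cube.weight_comp x σ).trans (Cube.weight_comp x σ').symm
    have hcard := D.card_seed_eq hj
    set T := Finset.univ.filter fun ω => D.point ω (σ j) = 0 ∧ D.point ω (σ' j) = 1 with hT
    have hmain := card_few_differences_le T (fun ω => pr fun i => D.point ω (σ i))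
      (fun ω => pr fun i => D.point ω (σ' i)) (fun o => o.1.1 j = 0)
      (fun ω hω => (Finset.mem_filter.1 hω).2.1)
      (fun ω hω h => by
        have h1 := (Finset.mem_filter.1 hω).2.2
        change D.point ω (σ' j) = 0 at h
        rw [h1] at h
        exact absurd h (by decide)) B hB
      (fun o => by
        refine le_trans ?_ (hspread σ o.1)
        rw [Nat.cast_le]
        refine Finset.card_le_card fun ω hω => ?_
        simp only [Finset.mem_filter, Finset.mem_univ, true_and] at hω ⊢
        exact congrArg Subtype.val hω.2)
    have hexp : (T.card : ℝ) / (8 * B) = Fintype.card (Seed n) / (32 * B) := by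
      rw [hcard]; push_cast; field_simp; ring
    rw [hexp] at hmain
    refine le_trans ?_ hmain
    rw [Nat.cast_le]
    refine Finset.card_le_card fun F hF => ?_
    simp only [E, Finset.mem_filter, Finset.mem_univ, true_and] at hF ⊢
    have hle : (T.filter fun ω => F (pr fun i => D.point ω (σ i)) ≠
        F (pr fun i => D.point ω (σ' i))).card ≤
        (Finset.univ.filter fun ω : Seed n => (Ψ F).permute σ (D.point ω) ≠
          (Ψ F).permute σ' (D.point ω)).card :=
      Finset.card_le_card (Finset.filter_subset_filter _ (Finset.subset_univ _))
    have hlt : 32 * (Finset.univ.filter fun ω : Seed n => (Ψ F).permute σ (D.point ω) ≠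
          (Ψ F).permute σ' (D.point ω)).card < Fintype.card (Seed n) := hF.2
    omega
  have hsub : {f : BoolFun n | f.IsSymmetricOn S ∧ ¬ D.Separates S f} ⊆
      Ψ '' ((Finset.univ.biUnion E : Finset (O → ZMod 2)) : Set (O → ZMod 2)) := by
    rintro f ⟨hf, hsep⟩
    obtain ⟨F, rfl⟩ := hΨsurj f hf
    refine ⟨F, ?_, rfl⟩
    unfold Separates at hsep
    push Not at hsep
    obtain ⟨a, a', h1, h2⟩ := hsep
    simp only [Finset.coe_biUnion, Set.mem_iUnion, Finset.mem_coe, Finset.mem_univ, E,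
      Finset.mem_filter, true_and, exists_prop]
    exact ⟨(a, a'), h1, h2⟩
  have hH : Fintype.card H = Fintype.card K ^ k := by
    simp only [H, Fintype.card_fun, hS]
  calc ({f : BoolFun n | f.IsSymmetricOn S ∧ ¬ D.Separates S f}.ncard : ℝ)
      ≤ ((Finset.univ.biUnion E).card : ℝ) := by
        rw [Nat.cast_le]
        refine (Set.ncard_le_ncard hsub (Set.toFinite _)).trans ?_
        rw [Set.ncard_image_of_injective _ hΨinj, Set.ncard_coe_finset]
    _ ≤ ∑ p, ((E p).card : ℝ) := by exact_mod_cast Finset.card_biUnion_le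
    _ ≤ ∑ _p : H × H, (2 ^ Fintype.card O * Real.exp (-(Fintype.card (Seed n) / (32 * B)))) :=
        Finset.sum_le_sum fun p _ => hE p
    _ = _ := by
        rw [Finset.sum_const, Finset.card_univ, Fintype.card_prod, hH, hsym, nsmul_eq_mul]
        push_cast
        ring

end QueryDesign

theorem card_seed (n : ℕ) : Fintype.card (Seed n) = 2 ^ n * 4 := by
  rw [Fintype.card_prod, Fintype.card_fun, Fintype.card_fun]; simp

/-- The design whose queries are uniformly random, with every variable in its own class. -/
def QueryDesign.uniform {n : ℕ} (x : Cube n) (k : ℕ) : QueryDesign x k (Fin n) where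
  point ω := ω.1
  cls i := i
  eq_of_cls_eq i i' h := by rw [h]
  mem_orbit ω := ⟨1, x.stab.one_mem, rfl⟩
  flip b := by
    let φ : Seed n → Seed n := fun ω => (fun i => if x i = b then ω.1 i + 1 else ω.1 i, ω.2)
    have hφ : Function.Involutive φ := by
      intro ω
      refine Prod.ext (funext fun i => ?_) rfl
      simp only [φ]
      split_ifs
      · rw [add_assoc, show (1 : ZMod 2) + 1 = 0 from rfl, add_zero]
      · rfl
    exact ⟨hφ.toPerm, fun ω i => rfl⟩
  mismatch ω i := by
    rw [Finset.filter_false_of_mem]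
    · simp
    · rintro i' - ⟨-, i'', rfl, h⟩
      exact h rfl

theorem QueryDesign.uniform_spread {n k : ℕ} (x : Cube n) {S : Finset (Fin n)}
    (hS : Fintype.card {i // i ∉ S} = k) (σ : Equiv.Perm (Fin n))
    (o : ({i // i ∉ S} → ZMod 2) × ℕ) :
    ((Finset.univ.filter fun ω : Seed n =>
      Cube.profile S (fun i => (QueryDesign.uniform x k).point ω (σ i)) = o).card : ℝ) ≤
      Fintype.card (Seed n) / 2 ^ k := by
  have hcard : Fintype.card {i // i ∈ S} + k = n := by
    have := Fintype.card_subtype_compl (fun i => i ∈ S)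
    have h1 := Fintype.card_subtype_le (fun i => i ∈ S)
    rw [Fintype.card_fin] at this h1
    omega
  have h1 : (Finset.univ.filter fun ω : Seed n =>
      Cube.profile S (fun i => (QueryDesign.uniform x k).point ω (σ i)) = o).card ≤
      Fintype.card (({i // i ∈ S} → ZMod 2) × (ZMod 2 → Bool)) := by
    rw [← Finset.card_univ]
    refine Finset.card_le_card_of_injOn (fun ω => (fun i => ω.1 (σ i), ω.2))
      (fun _ _ => Finset.mem_coe.2 (Finset.mem_univ _)) ?_
    intro ω hω ω' hω' h
    simp only [Finset.coe_filter, Finset.mem_univ, true_and, Set.mem_ofPred_eq] at hω hω'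
    obtain ⟨h2, h3⟩ := Prod.ext_iff.1 h
    refine Prod.ext (funext fun i => ?_) h3
    obtain ⟨j, rfl⟩ := σ.surjective i
    by_cases hj : j ∈ S
    · exact congrFun h2 ⟨j, hj⟩
    · exact congrFun (Prod.ext_iff.1 (hω.trans hω'.symm)).1 ⟨j, hj⟩
  rw [le_div_iff₀ (by positivity)]
  have h2 : Fintype.card (({i // i ∈ S} → ZMod 2) × (ZMod 2 → Bool)) * 2 ^ k =
      Fintype.card (Seed n) := by
    rw [card_seed, Fintype.card_prod, Fintype.card_fun, Fintype.card_fun, ZMod.card]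
    conv_rhs => rw [← hcard]
    simp
    ring
  exact_mod_cast h2 ▸ Nat.mul_le_mul_right _ h1

theorem card_filter_lt_of_injOn {α : Type*} {A : Finset α} {r : α → ℕ}
    (hinj : Set.InjOn r A) (hlt : ∀ i ∈ A, r i < A.card) {t : ℕ} (ht : t ≤ A.card) :
    (A.filter fun i => r i < t).card = t := by
  classical
  have himg : A.image r = Finset.range A.card := by
    refine Finset.eq_of_subset_of_card_le ?_ ?_
    · intro a ha
      obtain ⟨i, hi, rfl⟩ := Finset.mem_image.1 ha
      exact Finset.mem_range.2 (hlt i hi)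
    · rw [Finset.card_image_of_injOn hinj, Finset.card_range]
  have h2 : (A.filter fun i => r i < t).image r = Finset.range t := by
    ext a
    simp only [Finset.mem_image, Finset.mem_filter, Finset.mem_range]
    constructor
    · rintro ⟨i, ⟨-, h⟩, rfl⟩; exact h
    · intro ha
      have : a ∈ A.image r := by rw [himg]; exact Finset.mem_range.2 (ha.trans_le ht)
      obtain ⟨i, hi, rfl⟩ := Finset.mem_image.1 this
      exact ⟨i, ⟨hi, ha⟩, rfl⟩
  rw [← Finset.card_image_of_injOn (hinj.mono (Finset.coe_subset.2 (Finset.filter_subset _ _))), h2,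
    Finset.card_range]

theorem mul_card_le_of_near {s : Finset ℕ} {m N : ℕ}
    (h : ∀ a ∈ s, ∀ b ∈ s, a ≤ b → (b - a) * m < N) : m * s.card ≤ N + m := by
  rcases s.eq_empty_or_nonempty with rfl | hne
  · simp
  have h1 := h _ (s.min'_mem hne) _ (s.max'_mem hne) (s.min'_le_max' hne)
  have h2 : s.card ≤ s.max' hne + 1 - s.min' hne := by
    rw [← Nat.card_Icc]
    refine Finset.card_le_card fun a ha => Finset.mem_Icc.2 ⟨s.min'_le a ha, s.le_max' a ha⟩
  have h3 := s.min'_le_max' hne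
  calc m * s.card ≤ m * ((s.max' hne - s.min' hne) + 1) := Nat.mul_le_mul_left _ (by omega)
    _ = (s.max' hne - s.min' hne) * m + m := by ring
    _ ≤ _ := by omega

namespace Cube

variable {n : ℕ}

/-- The number of variables at which `x` takes the value `b`. -/
def fibreCard (x : Cube n) (b : ZMod 2) : ℕ := (Finset.univ.filter fun i => x i = b).card

/-- The position of a variable within its fibre under `x`. -/
def rank (x : Cube n) (i : Fin n) : ℕ := (Finset.univ.filter fun j => x j = x i ∧ j < i).card

/-- The number of ones of `u` on a fibre of `x`. -/
def fibreOnes (x u : Cube n) (b : ZMod 2) : ℕ :=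
  (Finset.univ.filter fun i => x i = b ∧ u i = 1).card

theorem rank_lt_rank (x : Cube n) {i j : Fin n} (h : x i = x j) (hij : i < j) :
    x.rank i < x.rank j := by
  refine Finset.card_lt_card ⟨fun l hl => ?_, fun hcon => ?_⟩
  · simp only [Finset.mem_filter, Finset.mem_univ, true_and] at hl ⊢
    exact ⟨hl.1.trans h, hl.2.trans hij⟩
  · have : i ∈ Finset.univ.filter fun l => x l = x j ∧ l < j := by simp [h, hij]
    have := hcon this
    simp at this

theorem rank_injOn (x : Cube n) (b : ZMod 2) :
    Set.InjOn x.rank (Finset.univ.filter fun i => x i = b : Finset (Fin n)) := by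
  intro i hi j hj h
  simp only [Finset.coe_filter, Finset.mem_univ, true_and, Set.mem_ofPred_eq] at hi hj
  rcases lt_trichotomy i j with h1 | h1 | h1
  · exact absurd h (x.rank_lt_rank (hi.trans hj.symm) h1).ne
  · exact h1
  · exact absurd h (x.rank_lt_rank (hj.trans hi.symm) h1).ne'

theorem rank_lt (x : Cube n) (i : Fin n) : x.rank i < x.fibreCard (x i) := by
  refine Finset.card_lt_card ⟨fun l hl => ?_, fun hcon => ?_⟩
  · simp only [Finset.mem_filter, Finset.mem_univ, true_and] at hl ⊢
    exact hl.1
  · have : i ∈ Finset.univ.filter fun l => x l = x i := by simp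
    have := hcon this
    simp at this

theorem fibreOnes_le (x u : Cube n) (b : ZMod 2) : x.fibreOnes u b ≤ x.fibreCard b :=
  Finset.card_le_card fun i hi => by
    simp only [Finset.mem_filter, Finset.mem_univ, true_and] at hi ⊢
    exact hi.1

theorem card_rank_lt (x : Cube n) (b : ZMod 2) {t : ℕ} (ht : t ≤ x.fibreCard b) :
    (Finset.univ.filter fun i => x i = b ∧ x.rank i < t).card = t := by
  rw [← Finset.filter_filter]
  refine card_filter_lt_of_injOn (x.rank_injOn b) (fun i hi => ?_) ht
  have hi' : x i = b := by simpa using hi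
  exact hi' ▸ x.rank_lt i

/-- On every fibre of `x`, gather the ones of `u` at the first or at the last variables. -/
def gather (x : Cube n) (ω : Seed n) : Cube n := fun i =>
  if (if ω.2 (x i) then x.rank i < x.fibreOnes ω.1 (x i)
    else x.fibreCard (x i) - x.fibreOnes ω.1 (x i) ≤ x.rank i) then 1 else 0

theorem gather_eq_one_iff (x : Cube n) (ω : Seed n) (i : Fin n) : x.gather ω i = 1 ↔
    if ω.2 (x i) then x.rank i < x.fibreOnes ω.1 (x i)
    else x.fibreCard (x i) - x.fibreOnes ω.1 (x i) ≤ x.rank i := by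
  rw [gather, ite_eq_left_iff, show (0 : ZMod 2) = 1 ↔ False by decide, imp_false, not_not]

theorem fibreOnes_gather (x : Cube n) (ω : Seed n) (b : ZMod 2) :
    x.fibreOnes (x.gather ω) b = x.fibreOnes ω.1 b := by
  have hle := x.fibreOnes_le ω.1 b
  cases hb : ω.2 b
  · have h1 : (Finset.univ.filter fun i => x i = b ∧ x.gather ω i = 1) =
        (Finset.univ.filter fun i => x i = b) \
          Finset.univ.filter fun i => x i = b ∧ x.rank i < x.fibreCard b - x.fibreOnes ω.1 b := by
      ext i
      simp only [Finset.mem_filter, Finset.mem_univ, true_and, Finset.mem_sdiff, not_and, not_lt,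
        gather_eq_one_iff]
      constructor
      · rintro ⟨rfl, h⟩
        simp only [hb] at h
        exact ⟨rfl, fun _ => by simpa using h⟩
      · rintro ⟨rfl, h⟩
        refine ⟨rfl, ?_⟩
        simp only [hb]
        simpa using h rfl
    have h2 := x.card_rank_lt b (Nat.sub_le (x.fibreCard b) (x.fibreOnes ω.1 b))
    change (Finset.univ.filter fun i => x i = b ∧ x.gather ω i = 1).card = _
    rw [h1, Finset.card_sdiff_of_subset, h2]
    · change x.fibreCard b - _ = _
      omega
    · intro i hi
      simp only [Finset.mem_filter, Finset.mem_univ, true_and] at hi ⊢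
      exact hi.1
  · rw [← x.card_rank_lt b hle]
    change (Finset.univ.filter fun i => x i = b ∧ x.gather ω i = 1).card = _
    congr 1
    ext i
    simp only [Finset.mem_filter, Finset.mem_univ, true_and, gather_eq_one_iff]
    constructor
    · rintro ⟨rfl, h⟩
      simp only [hb] at h
      exact ⟨rfl, by simpa using h⟩
    · rintro ⟨rfl, h⟩
      refine ⟨rfl, ?_⟩
      simp only [hb]
      simpa using h

theorem fibreOnes_flip (x u : Cube n) (b b' : ZMod 2) :
    x.fibreOnes (fun i => if x i = b then u i + 1 else u i) b' =
      if b' = b then x.fibreCard b' - x.fibreOnes u b' else x.fibreOnes u b' := by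
  have hz : ∀ t : ZMod 2, t + 1 = 1 ↔ ¬ t = 1 := by decide
  split_ifs with h
  · subst h
    unfold fibreOnes fibreCard
    rw [← Finset.card_sdiff_of_subset]
    · congr 1
      ext i
      simp only [Finset.mem_filter, Finset.mem_univ, true_and, Finset.mem_sdiff, not_and]
      constructor
      · rintro ⟨h1, h2⟩
        rw [if_pos h1, hz] at h2
        exact ⟨h1, fun _ => h2⟩
      · rintro ⟨h1, h2⟩
        rw [if_pos h1, hz]
        exact ⟨h1, h2 h1⟩
    · intro i hi
      simp only [Finset.mem_filter, Finset.mem_univ, true_and] at hi ⊢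
      exact hi.1
  · unfold fibreOnes
    congr 1
    ext i
    simp only [Finset.mem_filter, Finset.mem_univ, true_and]
    constructor
    · rintro ⟨rfl, h2⟩
      rw [if_neg h] at h2
      exact ⟨rfl, h2⟩
    · rintro ⟨rfl, h2⟩
      rw [if_neg h]
      exact ⟨rfl, h2⟩

end Cube

open Cube in
/-- The design whose queries are constant on most of `m` blocks into which each fibre of `x` is
divided. -/
def QueryDesign.gathered {n : ℕ} (x : Cube n) (k m : ℕ) (hm0 : 0 < m) (hm : 20000 * k ≤ m) :
    QueryDesign x k (ZMod 2 × Fin m) where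
  point := x.gather
  cls i := (x i, ⟨x.rank i * m / x.fibreCard (x i), by
    have := x.rank_lt i
    rw [Nat.div_lt_iff_lt_mul (by omega), mul_comm m]
    exact Nat.mul_lt_mul_of_pos_right this hm0⟩)
  eq_of_cls_eq i i' h := (Prod.ext_iff.1 h).1
  mem_orbit ω := by
    obtain ⟨π, h1, h2⟩ := exists_perm_of_card_ones_eq x (x.gather ω) ω.1
      fun b => x.fibreOnes_gather ω b
    exact ⟨π, h1, funext h2⟩
  flip b := by
    let φ : Seed n → Seed n := fun ω =>
      (fun i => if x i = b then ω.1 i + 1 else ω.1 i, fun c => if c = b then !ω.2 c else ω.2 c)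
    have hφ : Function.Involutive φ := by
      intro ω
      refine Prod.ext (funext fun i => ?_) (funext fun c => ?_)
      · simp only [φ]
        split_ifs
        · rw [add_assoc, show (1 : ZMod 2) + 1 = 0 from rfl, add_zero]
        · rfl
      · simp only [φ]
        split_ifs
        · exact Bool.not_not _
        · rfl
    refine ⟨hφ.toPerm, fun ω i => ?_⟩
    change x.gather (φ ω) i = _
    unfold gather
    simp only [φ, fibreOnes_flip]
    have hle := x.fibreOnes_le ω.1 (x i)
    by_cases h : x i = b
    · rw [if_pos h, if_pos h, if_pos h]
      cases hb : ω.2 (x i)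
      · by_cases h3 : x.rank i < x.fibreCard (x i) - x.fibreOnes ω.1 (x i)
        · simp only [h3, not_le.2 h3, Bool.not_false, if_true, if_false, Bool.false_eq_true, zero_add]
        · simp [h3, not_lt.1 h3, show (1 : ZMod 2) + 1 = 0 from rfl]
      · have : x.fibreCard (x i) - (x.fibreCard (x i) - x.fibreOnes ω.1 (x i)) =
            x.fibreOnes ω.1 (x i) := by omega
        rw [this]
        by_cases h3 : x.rank i < x.fibreOnes ω.1 (x i)
        · simp [h3, show (1 : ZMod 2) + 1 = 0 from rfl]
        · simp [h3, not_lt.1 h3]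
    · rw [if_neg h, if_neg h, if_neg h]
  mismatch ω i := by
    set N := x.fibreCard (x i) with hN
    set B := Finset.univ.filter fun i' => x i' = x i ∧ ∃ i'',
      ((x i'', (⟨x.rank i'' * m / x.fibreCard (x i''), _⟩ : Fin m)) : ZMod 2 × Fin m) =
        (x i', ⟨x.rank i' * m / x.fibreCard (x i'), _⟩) ∧ x.gather ω i'' ≠ x.gather ω i' with hB
    change 10000 * k * B.card ≤ N
    obtain ⟨t, ht⟩ : ∃ t, ∀ j j', x j = x i → x j' = x i → x.gather ω j ≠ x.gather ω j' →
        (x.rank j < t ∧ t ≤ x.rank j') ∨ (x.rank j' < t ∧ t ≤ x.rank j) := by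
      refine ⟨if ω.2 (x i) then x.fibreOnes ω.1 (x i) else N - x.fibreOnes ω.1 (x i), ?_⟩
      intro j j' hj hj' hne
      simp only [gather, hj, hj'] at hne
      cases hb : ω.2 (x i) <;> simp only [hb] at hne ⊢ <;> split_ifs at hne ⊢ <;>
        simp_all <;> omega
    have hblock : ∀ i' ∈ B, x i' = x i ∧ x.rank i' * m / N = t * m / N ∧ m < N := by
      intro i' hi'
      simp only [hB, Finset.mem_filter, Finset.mem_univ, true_and] at hi'
      obtain ⟨h1, i'', h2, h3⟩ := hi'
      have h4 : x i'' = x i := (Prod.ext_iff.1 h2).1.trans h1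
      have h5 : x.rank i'' * m / N = x.rank i' * m / N := by
        have := congrArg Fin.val (Prod.ext_iff.1 h2).2
        simp only [h4, h1] at this
        exact this
      have hNpos : 0 < N := lt_of_le_of_lt (Nat.zero_le _) (x.rank_lt i)
      have hmono : ∀ a b : ℕ, a ≤ b → a * m / N ≤ b * m / N := fun a b hab =>
        Nat.div_le_div_right (Nat.mul_le_mul_right m hab)
      have hstrict : N ≤ m → ∀ a b : ℕ, a < b → a * m / N < b * m / N := by
        intro hNm a b hab
        calc a * m / N < a * m / N + 1 := Nat.lt_succ_self _
          _ = (a * m + N) / N := (Nat.add_div_right _ hNpos).symm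
          _ ≤ b * m / N := Nat.div_le_div_right (by nlinarith)
      refine ⟨h1, ?_, ?_⟩
      · rcases ht i'' i' h4 h1 h3 with ⟨h6, h7⟩ | ⟨h6, h7⟩
        · have := hmono _ _ h6.le
          have := hmono _ _ h7
          omega
        · have := hmono _ _ h6.le
          have := hmono _ _ h7
          omega
      · by_contra hcon
        rcases ht i'' i' h4 h1 h3 with ⟨h6, h7⟩ | ⟨h6, h7⟩
        · have := hstrict (not_lt.1 hcon) _ _ (h6.trans_le h7)
          omega
        · have := hstrict (not_lt.1 hcon) _ _ (h6.trans_le h7)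
          omega
    rcases B.eq_empty_or_nonempty with h0 | ⟨i₁, hi₁⟩
    · rw [h0]; simp
    have hmN := (hblock i₁ hi₁).2.2
    have hcard : (B.image x.rank).card = B.card := by
      refine Finset.card_image_of_injOn ((x.rank_injOn (x i)).mono ?_)
      intro i' hi'
      have := (hblock i' hi').1
      simpa using this
    have hnear := mul_card_le_of_near (s := B.image x.rank) (m := m) (N := N) (by
      intro a ha b hb hab
      obtain ⟨j, hj, rfl⟩ := Finset.mem_image.1 ha
      obtain ⟨j', hj', rfl⟩ := Finset.mem_image.1 hb
      have h1 := (hblock j hj).2.1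
      have h2 := (hblock j' hj').2.1
      have hNpos : 0 < N := by omega
      have h3 := Nat.div_mul_le_self (x.rank j * m) N
      have h4 := Nat.lt_div_mul_add hNpos (a := x.rank j' * m)
      rw [h1] at h3
      rw [h2] at h4
      rw [Nat.sub_mul]
      omega)
    rw [hcard] at hnear
    have := Nat.mul_le_mul_right B.card hm
    nlinarith

theorem Nat.centralBinom_sq_mul_le (t : ℕ) : t.centralBinom ^ 2 * (2 * t + 1) ≤ 4 ^ (2 * t) := by
  induction t with
  | zero => simp
  | succ t ih =>
    have h := Nat.succ_mul_centralBinom_succ t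
    refine Nat.le_of_mul_le_mul_left (c := (t + 1) ^ 2) ?_ (by positivity)
    calc (t + 1) ^ 2 * ((t + 1).centralBinom ^ 2 * (2 * (t + 1) + 1))
        = ((t + 1) * (t + 1).centralBinom) ^ 2 * (2 * t + 3) := by ring
      _ = (4 * ((2 * t + 1) * (2 * t + 3))) * (t.centralBinom ^ 2 * (2 * t + 1)) := by
          rw [h]; ring
      _ ≤ (4 * (4 * (t + 1) ^ 2)) * 4 ^ (2 * t) := by
          refine Nat.mul_le_mul (Nat.mul_le_mul_left 4 ?_) ih
          nlinarith
      _ = _ := by ring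

theorem Nat.choose_sq_mul_le (n w : ℕ) : n.choose w ^ 2 * n ≤ 4 ^ n := by
  have hw : n.choose w ≤ n.choose (n / 2) := Nat.choose_le_middle w n
  suffices h : n.choose (n / 2) ^ 2 * (n + 1) ≤ 4 ^ n by
    refine le_trans (Nat.mul_le_mul (Nat.pow_le_pow_left hw 2) (Nat.le_succ n)) h
  rcases Nat.even_or_odd' n with ⟨t, rfl | rfl⟩
  · rw [Nat.mul_div_cancel_left t (by norm_num)]
    exact Nat.centralBinom_sq_mul_le t
  · have h1 : (2 * t + 1) / 2 = t := by omega
    have h2 : (t + 1).centralBinom = 2 * (2 * t + 1).choose t := by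
      rw [Nat.centralBinom_eq_two_mul_choose, show 2 * (t + 1) = 2 * t + 1 + 1 by ring,
        Nat.choose_succ_succ, Nat.choose_symm_half]
      ring
    have h3 := Nat.centralBinom_sq_mul_le (t + 1)
    rw [h2] at h3
    rw [h1]
    have h4 : 4 ^ (2 * (t + 1)) = 4 * 4 ^ (2 * t + 1) := by ring
    rw [h4] at h3
    nlinarith

theorem Cube.card_weight_eq (n w : ℕ) :
    (Finset.univ.filter fun z : Cube n => z.weight = w).card = n.choose w := by
  have h : n.choose w = (Finset.powersetCard w (Finset.univ : Finset (Fin n))).card := by simp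
  rw [h]
  refine Finset.card_bij (fun z _ => Finset.univ.filter fun i => z i = 1) ?_ ?_ ?_
  · intro z hz
    exact Finset.mem_powersetCard.2 ⟨Finset.subset_univ _, (Finset.mem_filter.1 hz).2⟩
  · intro z _ z' _ h
    funext i
    have h1 : z i = 1 ↔ z' i = 1 := by
      have := congrArg (i ∈ ·) h
      simpa using this
    revert h1
    generalize z i = a
    generalize z' i = b
    revert a b
    decide
  · intro A hA
    refine ⟨fun i => if i ∈ A then 1 else 0, ?_, ?_⟩
    · refine Finset.mem_filter.2 ⟨Finset.mem_univ _, ?_⟩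
      simpa [Cube.weight] using (Finset.mem_powersetCard.1 hA).2
    · ext i
      simp

theorem QueryDesign.weight_point {n k : ℕ} {x : Cube n} {K : Type} [DecidableEq K]
    (D : QueryDesign x k K) (ω : Seed n) : (D.point ω).weight = Cube.weight ω.1 := by
  obtain ⟨π, -, h⟩ := D.mem_orbit ω
  rw [h, Cube.weight_comp]

/-- The weight alone makes the profiles of the queries spread out. -/
theorem QueryDesign.weight_spread {n k : ℕ} {x : Cube n} {K : Type} [DecidableEq K]
    (D : QueryDesign x k K) (hn : 0 < n) {S : Finset (Fin n)} (σ : Equiv.Perm (Fin n))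
    (o : ({i // i ∉ S} → ZMod 2) × ℕ) :
    ((Finset.univ.filter fun ω : Seed n =>
      Cube.profile S (fun i => D.point ω (σ i)) = o).card : ℝ) ≤
      Fintype.card (Seed n) / Real.sqrt n := by
  have h1 : (Finset.univ.filter fun ω : Seed n =>
      Cube.profile S (fun i => D.point ω (σ i)) = o).card ≤ n.choose o.2 * 4 := by
    calc _ ≤ ((Finset.univ.filter fun z : Cube n => z.weight = o.2) ×ˢ
          (Finset.univ : Finset (ZMod 2 → Bool))).card := by
          refine Finset.card_le_card fun ω hω => ?_
          simp only [Finset.mem_filter, Finset.mem_univ, true_and, Finset.mem_product,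
            and_true] at hω ⊢
          rw [← D.weight_point ω, ← Cube.weight_comp _ σ]
          exact congrArg Prod.snd hω
      _ = _ := by
          rw [Finset.card_product, Cube.card_weight_eq, Finset.card_univ, Fintype.card_fun]
          simp
  have hs : 0 < Real.sqrt n := Real.sqrt_pos.2 (by exact_mod_cast hn)
  have h2 : (n.choose o.2 : ℝ) * Real.sqrt n ≤ 2 ^ n := by
    refine abs_le_of_sq_le_sq' ?_ (by positivity) |>.2
    rw [mul_pow, Real.sq_sqrt (Nat.cast_nonneg n), ← pow_mul, mul_comm n 2, pow_mul]
    have := Nat.choose_sq_mul_le n o.2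
    norm_num
    exact_mod_cast this
  rw [le_div_iff₀ hs, card_seed]
  calc _ ≤ ((n.choose o.2 * 4 : ℕ) : ℝ) * Real.sqrt n := by gcongr
    _ = (n.choose o.2 : ℝ) * Real.sqrt n * 4 := by push_cast; ring
    _ ≤ 2 ^ n * 4 := by gcongr
    _ = _ := by push_cast; ring

/-- Separation by designs for one point of every weight suffices for local correction. -/
theorem BoolFun.IsSymmetricOn.nonadaptivelyLocallyCorrectable {n k : ℕ} {K : Type} [DecidableEq K]
    [Fintype K] {y : Fin (n + 1) → Cube n} (hy : ∀ w, (y w).weight = w)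
    (D : ∀ w, QueryDesign (y w) k K) {S : Finset (Fin n)}
    (hS : Fintype.card {i // i ∉ S} = k) {f : BoolFun n} (hf : f.IsSymmetricOn S)
    (hD : ∀ w, (D w).Separates S f) {s : ℕ} (hs : 0 < s) (hsK : 10 * Fintype.card K ^ k ≤ 2 ^ s) :
    f.NonadaptivelyLocallyCorrectable (1 / 1000) (100 * s) := by
  choose P hP using fun w => (D w).exists_correcting hS hf (hD w) hs hsK
  have hτ : ∀ x : Cube n, ∃ τ : Equiv.Perm (Fin n),
      x = fun i => y ⟨x.weight, x.weight_lt⟩ (τ i) := fun x =>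
    Cube.exists_perm_of_weight_eq _ _ (hy ⟨x.weight, x.weight_lt⟩).symm
  choose τ hτ using hτ
  refine ⟨fun x => (P ⟨x.weight, x.weight_lt⟩).map fun Q =>
    ⟨fun j i => Q.query j (τ x i), Q.decide⟩, fun σ g hg x => ?_⟩
  let g' : BoolFun n := fun z => g fun i => z (τ x i)
  have hg' : g'.IsClose (1 / 1000) (f.permute (τ x * σ)) := by
    unfold BoolFun.IsClose at hg ⊢
    have : (Finset.univ.filter fun z : Cube n => g' z ≠ f.permute (τ x * σ) z).card =
        (Finset.univ.filter fun z : Cube n => g z ≠ f.permute σ z).card := by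
      refine Finset.card_bij (fun z _ i => z (τ x i)) ?_ ?_ ?_
      · intro z hz
        simp only [Finset.mem_filter, Finset.mem_univ, true_and] at hz ⊢
        exact hz
      · intro a _ b _ hab
        funext i
        have := congrFun hab ((τ x).symm i)
        simpa using this
      · intro b hb
        refine ⟨fun i => b ((τ x).symm i), ?_, by simp⟩
        simp only [Finset.mem_filter, Finset.mem_univ, true_and] at hb ⊢
        simpa [g', BoolFun.permute] using hb
    rw [this]
    exact hg
  have h := hP ⟨x.weight, x.weight_lt⟩ (τ x * σ) g' hg'
  have hx : f.permute (τ x * σ) (y ⟨x.weight, x.weight_lt⟩) = f.permute σ x := by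
    conv_rhs => rw [hτ x]
    rfl
  rw [hx] at h
  rw [PMF.map_comp]
  exact h

/-- A bound for the number of partially symmetric functions without a local corrector. -/
theorem ncard_not_correctable_le {n k : ℕ} (hkn : k ≤ n) {K : Type} [DecidableEq K]
    [Fintype K] (D : ∀ x : Cube n, QueryDesign x k K) {B : ℝ} (hB : 0 < B)
    (hspread : ∀ (x : Cube n) (S : Finset (Fin n)), Fintype.card {i // i ∉ S} = k →
      ∀ (σ : Equiv.Perm (Fin n)) o, ((Finset.univ.filter fun ω : Seed n =>
        Cube.profile S (fun i => (D x).point ω (σ i)) = o).card : ℝ) ≤ B)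
    {s : ℕ} (hs : 0 < s) (hsK : 10 * Fintype.card K ^ k ≤ 2 ^ s) :
    ({f : BoolFun n | f.IsPartiallySymmetric (n - k) ∧
        ¬ f.NonadaptivelyLocallyCorrectable (1 / 1000) (100 * s)}.ncard : ℝ) ≤
      ({f : BoolFun n | f.IsPartiallySymmetric (n - k)}.ncard : ℝ) *
        (n.choose k * (n + 1) * (((Fintype.card K : ℝ) ^ k) ^ 2 *
          Real.exp (-(Fintype.card (Seed n) / (32 * B))))) := by
  classical
  have hex : ∀ w : Fin (n + 1), ∃ z : Cube n, z.weight = w := by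
    intro w
    have h1 : 0 < (Finset.univ.filter fun z : Cube n => z.weight = w).card := by
      rw [Cube.card_weight_eq]
      exact Nat.choose_pos (Nat.lt_succ_iff.1 w.2)
    obtain ⟨z, hz⟩ := Finset.card_pos.1 h1
    exact ⟨z, by simpa using hz⟩
  choose y hy using hex
  set N : ℝ := ({f : BoolFun n | f.IsPartiallySymmetric (n - k)}.ncard : ℝ)
  set E : ℝ := ((Fintype.card K : ℝ) ^ k) ^ 2 * Real.exp (-(Fintype.card (Seed n) / (32 * B)))
  have hE : 0 ≤ E := by positivity
  let I := Finset.powersetCard (n - k) (Finset.univ : Finset (Fin n)) ×ˢ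
    (Finset.univ : Finset (Fin (n + 1)))
  let bad : Finset (Fin n) × Fin (n + 1) → Set (BoolFun n) := fun p =>
    {f | f.IsSymmetricOn p.1 ∧ ¬ (D (y p.2)).Separates p.1 f}
  have hcompl : ∀ S : Finset (Fin n), S.card = n - k → Fintype.card {i // i ∉ S} = k := by
    intro S hS
    rw [Fintype.card_subtype_compl, Fintype.card_fin, Fintype.card_coe, hS]
    omega
  have hsub : {f : BoolFun n | f.IsPartiallySymmetric (n - k) ∧
        ¬ f.NonadaptivelyLocallyCorrectable (1 / 1000) (100 * s)} ⊆ ⋃ p ∈ I, bad p := by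
    rintro f ⟨⟨S, hS, hf⟩, hnot⟩
    by_contra hcon
    simp only [Set.mem_iUnion, exists_prop, not_exists, not_and, I, Finset.mem_product,
      Finset.mem_powersetCard, Finset.subset_univ, true_and, Finset.mem_univ, and_true] at hcon
    refine hnot (hf.nonadaptivelyLocallyCorrectable hy (fun w => D (y w)) (hcompl S hS)
      (fun w => ?_) hs hsK)
    by_contra hsep
    exact hcon (S, w) hS ⟨hf, hsep⟩
  have hbad : ∀ p ∈ I, ((bad p).ncard : ℝ) ≤ N * E := by
    rintro ⟨S, w⟩ hp
    simp only [I, Finset.mem_product, Finset.mem_powersetCard, Finset.subset_univ, true_and,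
      Finset.mem_univ, and_true] at hp
    refine ((D (y w)).ncard_not_separates_le (hcompl S hp) hB
      (hspread (y w) S (hcompl S hp))).trans ?_
    refine mul_le_mul_of_nonneg_right ?_ hE
    rw [Nat.cast_le]
    exact Set.ncard_le_ncard (fun f hf => ⟨S, hp, hf⟩) (Set.toFinite _)
  calc _ ≤ ((⋃ p ∈ I, bad p).ncard : ℝ) := by
        rw [Nat.cast_le]
        exact Set.ncard_le_ncard hsub (Set.toFinite _)
    _ ≤ ∑ p ∈ I, ((bad p).ncard : ℝ) := by
        exact_mod_cast Finset.set_ncard_biUnion_le I bad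
    _ ≤ ∑ _p ∈ I, N * E := Finset.sum_le_sum hbad
    _ = _ := by
        rw [Finset.sum_const, Finset.card_product, Finset.card_powersetCard, Finset.card_univ,
          Finset.card_univ, Fintype.card_fin, Fintype.card_fin, Nat.choose_symm hkn, nsmul_eq_mul]
        push_cast
        ring

theorem BoolFun.nonadaptivelyLocallyCorrectable_of_symmetric {n : ℕ} {f : BoolFun n}
    (hf : f.IsPartiallySymmetric n) (ε : ℝ) : f.NonadaptivelyLocallyCorrectable ε 0 := by
  obtain ⟨S, hS, hf⟩ := hf
  have hSu : S = Finset.univ := Finset.eq_univ_of_card S (by simpa using hS)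
  subst hSu
  refine ⟨fun x => PMF.pure ⟨Fin.elim0, fun _ => f x⟩, fun σ g _ x => ?_⟩
  rw [hf σ (by simp), PMF.pure_map]
  simp only [NonadaptiveProcedure.output, PMF.pure_apply, if_true]
  exact ENNReal.div_le_of_le_mul (by norm_num)

/-- The number of trials used for the correction, up to a factor `100`. -/
theorem exists_trials {k : ℕ} (hk : 0 < k) : ∃ s : ℕ, 0 < s ∧
    10 * (40000 * k ^ 8) ^ k ≤ 2 ^ s ∧
    ((100 * s : ℕ) : ℝ) ≤ 14000 * (k * Real.log (k + 1) ^ 2) := by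
  set l := Nat.log 2 k + 1 with hl
  have hkl : k ≤ 2 ^ l := (Nat.lt_pow_succ_log_self (by norm_num) k).le
  refine ⟨28 * l * k, by positivity, ?_, ?_⟩
  · have h1 : 40000 * k ^ 8 ≤ 2 ^ (24 * l) := by
      calc 40000 * k ^ 8 ≤ 2 ^ (16 * l) * (2 ^ l) ^ 8 := by
            refine Nat.mul_le_mul ?_ (Nat.pow_le_pow_left hkl 8)
            calc 40000 ≤ 2 ^ 16 := by norm_num
              _ ≤ _ := Nat.pow_le_pow_right (by norm_num) (by omega)
        _ = _ := by rw [← pow_mul, ← pow_add]; congr 1; ring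
    calc 10 * (40000 * k ^ 8) ^ k ≤ 2 ^ (4 * l * k) * (2 ^ (24 * l)) ^ k := by
          refine Nat.mul_le_mul ?_ (Nat.pow_le_pow_left h1 k)
          calc 10 ≤ 2 ^ 4 := by norm_num
            _ ≤ _ := Nat.pow_le_pow_right (by norm_num) (by nlinarith [Nat.le_add_left 1 (Nat.log 2 k)])
      _ = _ := by rw [← pow_mul, ← pow_add]; congr 1; ring
  · set L := Real.log (k + 1) with hL
    have hlog2 : 0.69 < Real.log 2 := by have := Real.log_two_gt_d9; linarith
    have hk1 : (1 : ℝ) ≤ k := by exact_mod_cast hk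
    have hL2 : Real.log 2 ≤ L := Real.log_le_log (by norm_num) (by linarith)
    have h1 : (Nat.log 2 k : ℝ) * Real.log 2 ≤ L := by
      rw [← Real.log_pow]
      refine Real.log_le_log (by positivity) ?_
      have : 2 ^ Nat.log 2 k ≤ k := Nat.pow_log_le_self 2 hk.ne'
      have : ((2 ^ Nat.log 2 k : ℕ) : ℝ) ≤ k := by exact_mod_cast this
      push_cast at this
      linarith
    have h2 : (l : ℝ) ≤ 5 * L ^ 2 := by
      have hl' : (l : ℝ) = Nat.log 2 k + 1 := by rw [hl]; push_cast; ring
      have h3 : (l : ℝ) * Real.log 2 ≤ 2 * L := by rw [hl']; linarith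
      have h4 : (l : ℝ) * 0.69 ≤ 2 * L := by
        refine le_trans ?_ h3
        gcongr
      nlinarith
    push_cast
    calc (100 : ℝ) * (28 * l * k) = 2800 * k * l := by ring
      _ ≤ 2800 * k * (5 * L ^ 2) := by gcongr
      _ = _ := by ring

theorem exists_sqrt_exponent_le (M : ℝ) : ∃ n₀ : ℕ, ∀ n k : ℕ, n₀ ≤ n → 40000 * k ^ 8 < n →
    4 * k * Real.log (n + 1) - Real.sqrt n / 32 ≤ -M := by
  obtain ⟨n₀, hn₀⟩ := exists_nat_ge ((max M 100) ^ 8)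
  refine ⟨n₀, fun n k hn hk => ?_⟩
  set t := Real.sqrt (Real.sqrt (Real.sqrt n)) with ht
  have ht4 : t ^ 4 = Real.sqrt n := by
    rw [show t ^ 4 = (t ^ 2) ^ 2 by ring, ht, Real.sq_sqrt (by positivity),
      Real.sq_sqrt (by positivity)]
  have ht8 : t ^ 8 = n := by
    rw [show t ^ 8 = (t ^ 4) ^ 2 by ring, ht4, Real.sq_sqrt (by positivity)]
  have ht0 : 0 ≤ t := Real.sqrt_nonneg _
  have htM : max M 100 ≤ t := by
    refine le_of_pow_le_pow_left₀ (n := 8) (by norm_num) ht0 ?_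
    rw [ht8]
    exact hn₀.trans (by exact_mod_cast hn)
  have h100 : 100 ≤ t := (le_max_right _ _).trans htM
  have hM : M ≤ t := (le_max_left _ _).trans htM
  have hkt : (k : ℝ) ≤ t := by
    refine le_of_pow_le_pow_left₀ (n := 8) (by norm_num) ht0 ?_
    rw [ht8]
    have : k ^ 8 ≤ n := by omega
    exact_mod_cast this
  have hlog : Real.log (n + 1) ≤ 1 + 8 * t := by
    have h1 : (n : ℝ) + 1 ≤ 2 * t ^ 8 := by
      rw [ht8]
      have : (1 : ℝ) ≤ n := by rw [← ht8]; exact one_le_pow₀ (by linarith)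
      linarith
    calc Real.log (n + 1) ≤ Real.log (2 * t ^ 8) := Real.log_le_log (by positivity) h1
      _ = Real.log 2 + 8 * Real.log t := by
        rw [Real.log_mul (by norm_num) (by positivity), Real.log_pow]; norm_num
      _ ≤ _ := by
        have := Real.log_two_lt_d9
        have := Real.log_le_self ht0
        linarith
  have hprod : 4 * k * Real.log (n + 1) ≤ 4 * t * (1 + 8 * t) := by
    have : 0 ≤ Real.log (n + 1) := Real.log_nonneg (by linarith [Nat.cast_nonneg (α := ℝ) n])
    gcongr
  rw [← ht4]
  have h2 : 10000 * t ^ 2 ≤ t ^ 4 := by nlinarith [mul_le_mul h100 h100 (by norm_num) ht0, sq_nonneg t]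
  nlinarith

theorem exists_two_pow_exponent_le (M : ℝ) : ∃ n₀ : ℕ, ∀ n k : ℕ, n₀ ≤ n → n ≤ 40000 * k ^ 8 →
    4 * k * Real.log (n + 1) - 2 ^ k / 32 ≤ -M := by
  have hlim := tendsto_pow_const_div_const_pow_of_one_lt 3 (r := (2 : ℝ)) (by norm_num)
  obtain ⟨k₀, hk₀⟩ := eventually_atTop.1 
    (hlim.eventually_le_const (show (0 : ℝ) < 1 / 32 by norm_num))
  obtain ⟨k₁, hk₁⟩ := exists_nat_ge M
  set k₂ := max (max k₀ k₁) 100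
  refine ⟨40000 * k₂ ^ 8, fun n k hn hk => ?_⟩
  have hkk : k₂ ≤ k := by
    have : k₂ ^ 8 ≤ k ^ 8 := by omega
    exact (Nat.pow_le_pow_iff_left (by norm_num)).1 this
  have h0 : k₀ ≤ k := ((le_max_left _ _).trans (le_max_left _ _)).trans hkk
  have h1 : (M : ℝ) ≤ k := hk₁.trans
    (by exact_mod_cast ((le_max_right _ _).trans (le_max_left _ _)).trans hkk)
  have h2 : (100 : ℝ) ≤ k := by exact_mod_cast (le_max_right _ _).trans hkk
  have h3 : (k : ℝ) ^ 3 ≤ 2 ^ k / 32 := by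
    have := hk₀ k h0
    rw [div_le_iff₀ (by positivity)] at this
    linarith
  have hlog : Real.log (n + 1) ≤ 12 + 8 * k := by
    have h4 : (n : ℝ) + 1 ≤ 2 ^ 16 * (k : ℝ) ^ 8 := by
      have h5 : (n : ℝ) ≤ 40000 * (k : ℝ) ^ 8 := by exact_mod_cast hk
      have h6 : (1 : ℝ) ≤ (k : ℝ) ^ 8 := one_le_pow₀ (by linarith)
      linarith
    calc Real.log (n + 1) ≤ Real.log (2 ^ 16 * (k : ℝ) ^ 8) := Real.log_le_log (by positivity) h4
      _ = 16 * Real.log 2 + 8 * Real.log k := by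
        rw [Real.log_mul (by norm_num) (by positivity), Real.log_pow, Real.log_pow]; norm_num
      _ ≤ _ := by
        have := Real.log_two_lt_d9
        have := Real.log_le_self (Nat.cast_nonneg (α := ℝ) k)
        linarith
  have hprod : 4 * k * Real.log (n + 1) ≤ 4 * k * (12 + 8 * k) := by gcongr
  have h7 : 100 * (k : ℝ) ^ 2 ≤ (k : ℝ) ^ 3 := by nlinarith [sq_nonneg (k : ℝ)]
  nlinarith

/-- The fraction of the `(n - k)`-symmetric functions which need more than
`14000 k log² (k + 1)` queries. -/
noncomputable def uncorrectableFraction (n k : ℕ) : ℝ :=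
  ({f : BoolFun n | f.IsPartiallySymmetric (n - k) ∧
      ¬ ∃ q : ℕ, (q : ℝ) ≤ 14000 * (k * Real.log (k + 1) ^ 2) ∧
        f.NonadaptivelyLocallyCorrectable (1 / 1000) q}.ncard : ℝ) /
    ({f : BoolFun n | f.IsPartiallySymmetric (n - k)}.ncard : ℝ)

theorem uncorrectableFraction_zero (n : ℕ) : uncorrectableFraction n 0 = 0 := by
  have : {f : BoolFun n | f.IsPartiallySymmetric (n - 0) ∧
      ¬ ∃ q : ℕ, (q : ℝ) ≤ 14000 * ((0 : ℕ) * Real.log ((0 : ℕ) + 1) ^ 2) ∧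
        f.NonadaptivelyLocallyCorrectable (1 / 1000) q} = ∅ := by
    rw [Set.eq_empty_iff_forall_notMem]
    rintro f ⟨hf, hnot⟩
    exact hnot ⟨0, by simp, BoolFun.nonadaptivelyLocallyCorrectable_of_symmetric hf _⟩
  rw [uncorrectableFraction, this]
  simp

/-- The exponential bound that a family of designs gives. -/
theorem uncorrectableFraction_le_of_designs {n k : ℕ} (hk : 0 < k) (hkn : k ≤ n) {K : Type}
    [DecidableEq K] [Fintype K] (hKn : Fintype.card K ≤ n) (hKk : Fintype.card K ≤ 40000 * k ^ 8)
    (D : ∀ x : Cube n, QueryDesign x k K) {c : ℝ} (hc : 0 < c)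
    (hspread : ∀ (x : Cube n) (S : Finset (Fin n)), Fintype.card {i // i ∉ S} = k →
      ∀ (σ : Equiv.Perm (Fin n)) o, ((Finset.univ.filter fun ω : Seed n =>
        Cube.profile S (fun i => (D x).point ω (σ i)) = o).card : ℝ) ≤
          Fintype.card (Seed n) / c) :
    uncorrectableFraction n k ≤ Real.exp (4 * k * Real.log (n + 1) - c / 32) := by
  obtain ⟨s, hs, hs2, hsq⟩ := exists_trials hk
  have hW : (0 : ℝ) < Fintype.card (Seed n) := by exact_mod_cast Fintype.card_pos
  have h := ncard_not_correctable_le hkn D (div_pos hW hc) hspread hs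
    ((Nat.mul_le_mul_left 10 (Nat.pow_le_pow_left hKk k)).trans hs2)
  have hexp : (Fintype.card (Seed n) : ℝ) / (32 * (Fintype.card (Seed n) / c)) = c / 32 := by
    field_simp
  rw [hexp] at h
  set N : ℝ := ({f : BoolFun n | f.IsPartiallySymmetric (n - k)}.ncard : ℝ)
  have hsub : {f : BoolFun n | f.IsPartiallySymmetric (n - k) ∧
      ¬ ∃ q : ℕ, (q : ℝ) ≤ 14000 * (k * Real.log (k + 1) ^ 2) ∧
        f.NonadaptivelyLocallyCorrectable (1 / 1000) q} ⊆
      {f : BoolFun n | f.IsPartiallySymmetric (n - k) ∧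
        ¬ f.NonadaptivelyLocallyCorrectable (1 / 1000) (100 * s)} :=
    fun f hf => ⟨hf.1, fun hcor => hf.2 ⟨_, hsq, hcor⟩⟩
  unfold uncorrectableFraction
  refine div_le_of_le_mul₀ (Nat.cast_nonneg _) (Real.exp_pos _).le ?_
  calc _ ≤ _ := Nat.cast_le.2 (Set.ncard_le_ncard hsub (Set.toFinite _))
    _ ≤ _ := h
    _ ≤ N * Real.exp (4 * k * Real.log (n + 1) - c / 32) := ?_
    _ = _ := mul_comm _ _
  refine mul_le_mul_of_nonneg_left ?_ (Nat.cast_nonneg _)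
  have hn1 : (1 : ℝ) ≤ n + 1 := by linarith [Nat.cast_nonneg (α := ℝ) n]
  have h1 : (n.choose k : ℝ) ≤ (n + 1) ^ k := by
    have : n.choose k ≤ (n + 1) ^ k :=
      (Nat.choose_le_pow n k).trans (Nat.pow_le_pow_left (Nat.le_succ n) k)
    exact_mod_cast this
  have h2 : (Fintype.card K : ℝ) ≤ n + 1 := by exact_mod_cast hKn.trans (Nat.le_succ n)
  have h3 : Real.exp (4 * k * Real.log (n + 1)) = ((n : ℝ) + 1) ^ (4 * k) := by
    rw [← Real.exp_log (show (0 : ℝ) < n + 1 by linarith), ← Real.exp_nat_mul, Real.log_exp]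
    push_cast
    rfl
  have h4 : ((n : ℝ) + 1) ≤ (n + 1) ^ k := le_self_pow₀ hn1 hk.ne'
  rw [sub_eq_add_neg, Real.exp_add, h3, ← mul_assoc]
  refine mul_le_mul_of_nonneg_right ?_ (Real.exp_pos _).le
  calc (n.choose k : ℝ) * (n + 1) * ((Fintype.card K : ℝ) ^ k) ^ 2
      ≤ (n + 1) ^ k * (n + 1) ^ k * (((n : ℝ) + 1) ^ k) ^ 2 := by gcongr
    _ = _ := by ring

theorem exists_uncorrectableFraction_le (M : ℝ) : ∃ n₀ : ℕ, ∀ n k : ℕ, n₀ ≤ n → k ≤ n →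
    uncorrectableFraction n k ≤ Real.exp (-M) := by
  obtain ⟨n₁, h₁⟩ := exists_sqrt_exponent_le M
  obtain ⟨n₂, h₂⟩ := exists_two_pow_exponent_le M
  refine ⟨max n₁ n₂, fun n k hn hkn => ?_⟩
  rcases Nat.eq_zero_or_pos k with rfl | hk
  · rw [uncorrectableFraction_zero]; exact (Real.exp_pos _).le
  have hn0 : 0 < n := hk.trans_le hkn
  have hk8 : k ≤ k ^ 8 := Nat.le_self_pow (by norm_num) k
  rcases lt_or_ge (40000 * k ^ 8) n with hlt | hge
  · have hcard : Fintype.card (ZMod 2 × Fin (20000 * k ^ 8)) = 40000 * k ^ 8 := by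
      rw [Fintype.card_prod, ZMod.card, Fintype.card_fin]; ring
    refine (uncorrectableFraction_le_of_designs hk hkn (hcard.trans_le hlt.le) hcard.le
      (fun x => QueryDesign.gathered x k (20000 * k ^ 8) (by positivity) (by omega))
      (Real.sqrt_pos.2 (by exact_mod_cast hn0)) fun x S _ σ o =>
        (QueryDesign.gathered x k _ _ _).weight_spread hn0 σ o).trans ?_
    exact Real.exp_le_exp.2 (h₁ n k ((le_max_left _ _).trans hn) hlt)
  · refine (uncorrectableFraction_le_of_designs hk hkn (by simp) (by simpa using hge)
      (fun x => QueryDesign.uniform x k) (c := 2 ^ k) (by positivity) fun x S hS σ o =>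
        QueryDesign.uniform_spread x hS σ o).trans ?_
    exact Real.exp_le_exp.2 (h₂ n k ((le_max_right _ _).trans hn) hge)

theorem theorem2 :
    ∃ C : ℝ, 0 < C ∧ ∃ δ : ℕ → ℝ, Tendsto δ atTop (𝓝 0) ∧
      ∀ n k : ℕ, k ≤ n →
        ({f : BoolFun n | f.IsPartiallySymmetric (n - k) ∧
            ¬ ∃ q : ℕ, (q : ℝ) ≤ C * (k * Real.log (k + 1) ^ 2) ∧
              f.NonadaptivelyLocallyCorrectable (1 / 1000) q}.ncard : ℝ) /
          ({f : BoolFun n | f.IsPartiallySymmetric (n - k)}.ncard : ℝ) ≤ δ n := by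
  refine ⟨14000, by norm_num, fun n => ⨆ k : Fin (n + 1), uncorrectableFraction n k, ?_, ?_⟩
  · rw [Metric.tendsto_atTop]
    intro ε hε
    obtain ⟨n₀, hn₀⟩ := exists_uncorrectableFraction_le (-Real.log (ε / 2))
    refine ⟨n₀, fun n hn => ?_⟩
    have h1 : ⨆ k : Fin (n + 1), uncorrectableFraction n k ≤ ε / 2 := by
      refine ciSup_le fun k => ?_
      have := hn₀ n k hn (Nat.lt_succ_iff.1 k.2)
      rwa [neg_neg, Real.exp_log (by positivity)] at this
    have h2 : 0 ≤ ⨆ k : Fin (n + 1), uncorrectableFraction n k :=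
      Real.iSup_nonneg fun k => div_nonneg (Nat.cast_nonneg _) (Nat.cast_nonneg _)
    rw [Real.dist_eq, sub_zero, abs_of_nonneg h2]
    linarith
  · intro n k hkn
    exact le_ciSup (f := fun k : Fin (n + 1) => uncorrectableFraction n k)
      (Set.toFinite _).bddAbove ⟨k, Nat.lt_succ_of_le hkn⟩
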